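/- **Setting.** Let $\tau$ be an algebraic language (no relation symbols); algebras are nonempty. $Tm(\tau)$ is the set of $\tau$-terms (formulas) over a fixed countably infinite set of variables $x_1,x_2,\dots$. A *logic* in $\tau$ is a finitary structural (substitution-invariant) consequence relation on $Tm(\tau)$. A *quasivariety* is a class of algebras axiomatized by quasi-identities. Let $L$ be a finitely algebraizable logic in $\tau$ with equivalent algebraic semantics the quasivariety $\mathcal Q$, via the finite set $\Delta(x,y)$ of equivalence formulas and the set $\varepsilon(x)$ of defining equations; that is, for all sets $\Gamma\cup\{\varphi\}$ of formulas and $\Theta\cup\{s=t\}$ of equations: $\Gamma\vdash_L\varphi$ iff $\varepsilon(\Gamma)\vDash_{\mathcal Q}\varepsilon(\varphi)$; $\Theta\vDash_{\mathcal Q}s=t$ iff $\Delta(\Theta)\vdash_L\Delta(s,t)$; $\varphi\dashv\vdash_L\Delta(\varepsilon(\varphi))$; and $s=t$ and $\varepsilon(\Delta(s,t))$ are equivalent with respect to $\vDash_{\mathcal Q}$. An *EFD-sentence* is a sentence $\varphi=\forall x_1\dots x_n\,\exists!\,z_1\dots z_m\,\alpha(\bar x,\bar z)$ with $n\ge 0$,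 $m\ge 1$ and $\alpha$ a finite conjunction of $\tau$-equations $s_i=t_i$. For a set $\Sigma$ of EFD-sentences, $\tau_\Sigma$ is $\tau$ with new distinct $n$-ary symbols $f^\varphi_1,\dots,f^\varphi_m$ added for each $\varphi\in\Sigma$. $\mathcal Q^\Sigma$ is the class of $\tau_\Sigma$-algebras whose $\tau$-reduct is in $\mathcal Q$ and that satisfy, for each $\varphi\in\Sigma$, $\forall\bar x\,\alpha(\bar x,f^\varphi_1(\bar x),\dots,f^\varphi_m(\bar x))$ and $\alpha(\bar x,\bar y)\wedge\alpha(\bar x,\bar z)\to\bar y=\bar z$. An *AE-subclass* of $\mathcal Q$ is a class of the form $\mathcal Q\cap\mathrm{Mod}(\Sigma)$. For a family $F$ of finite sets $\Phi(x_1,\dots,x_n,z_1,\dots,z_m)$ of $\tau$-formulas ($n,m\ge0$), $\tau_F$ is $\tau$ with new distinct $n$-ary symbols $f^\Phi_1,\dots,f^\Phi_m$ added for each member $\Phi$, and the *algebraic expansion* $L^F$ is the least logic in $\tau_F$ that contains $L$ and satisfies, for each member $\Phi$, $\vdash\Phi(\bar x,f^\Phi_1(\bar x),\dots,f^\Phi_m(\bar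 x))$ and $\Phi(\bar x,\bar y),\Phi(\bar x,\bar z)\vdash\Delta(y_j,z_j)$ for $1\le j\le m$. For a set $\Sigma$ of EFD-sentences, $L^\Sigma$ is the expansion, in the language $\tau_\Sigma$, by the sets $d(\varphi)=\bigcup_i\Delta(s_i,t_i)$, $\varphi\in\Sigma$. Also, $e(\Phi)$ is the condition $\forall\bar x\,\exists!\bar z\,\bigwedge\varepsilon(\Phi(\bar x,\bar z))$, and $e(F)$ is the set of these conditions for the members of $F$. Let $\tau_1,\tau_2$ be expansions of $\tau$. A *$\tau$-translation* $T$ from $\tau_1$ into $\tau_2$ sends each $n$-ary symbol of $\tau_1$ to a $\tau_2$-term in $x_1,\dots,x_n$ (a closed term if $n=0$), with $T(f)=f(x_1,\dots,x_n)$ for $f\in\tau$; it extends to terms in the natural way. It is a *$\tau$-interpretation* of $\mathcal K_1$ in $\mathcal K_2$ if for each $\mathbf A\in\mathcal K_2$ the algebra $\mathbf A^T=(A,\{T(f)^{\mathbf A}:f\in\tau_1\})$ is in $\mathcal K_1$, and a *$\tau$-morphism* from $L_1$ to $L_2$ if $\Gamma\vdash_{L_1}\varphi$ implies $T(\Gamma)\vdash_{L_2}T(\varphi)$.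 $\mathcal K_1,\mathcal K_2$ are *$\tau$-term-equivalent* if there are $\tau$-interpretations $T$ of $\mathcal K_1$ in $\mathcal K_2$ and $S$ of $\mathcal K_2$ in $\mathcal K_1$ such that $\mathbf A\mapsto\mathbf A^T$ and $\mathbf A\mapsto\mathbf A^S$ are mutually inverse. $L_1,L_2$ are *$\tau$-equipollent* if there are $\tau$-morphisms $T$ from $L_1$ to $L_2$ and $S$ from $L_2$ to $L_1$ with $\varphi\dashv\vdash_{L_1}S(T(\varphi))$ and $\psi\dashv\vdash_{L_2}T(S(\psi))$ for all $\varphi\in Tm(\tau_1)$, $\psi\in Tm(\tau_2)$. **Theorem.** Let $\Sigma,\Sigma'$ be sets of EFD-sentences in $\tau$. 1. Consider the conditions: (i) there is a $\tau$-morphism from $L^{\Sigma'}$ to $L^\Sigma$; (ii) there is a $\tau$-interpretation of $\mathcal Q^{\Sigma'}$ in $\mathcal Q^\Sigma$; (iii) $\mathcal Q\cap\mathrm{Mod}(\Sigma)\subseteq\mathcal Q\cap\mathrm{Mod}(\Sigma')$. Then (i)$\Leftrightarrow$(ii)$\Rightarrow$(iii), and all three are equivalent provided that $\tau_\Sigma$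 has a constant symbol if $\tau_{\Sigma'}$ has one (as is the case when $\tau$ has a constant symbol, and when all sentences in $\Sigma'$ have $n\ge1$). 2. Consider the conditions: (i) $L^{\Sigma'}$ and $L^\Sigma$ are $\tau$-equipollent; (ii) $\mathcal Q^{\Sigma'}$ and $\mathcal Q^\Sigma$ are $\tau$-term-equivalent; (iii) $\mathcal Q\cap\mathrm{Mod}(\Sigma)=\mathcal Q\cap\mathrm{Mod}(\Sigma')$. Then (i)$\Leftrightarrow$(ii)$\Rightarrow$(iii), and all three are equivalent provided that $\tau_\Sigma$ has a constant symbol if and only if $\tau_{\Sigma'}$ has one. 3. Consider the algebraic expansions $L^F$ of $L$ such that $\tau_F$ has a constant symbol only if $\tau$ has one (all algebraic expansions, if $\tau$ has a constant symbol). Modulo $\tau$-equipollence and ordered by the existence of $\tau$-morphisms (the class of $L^F$ is below the class of $L^{F'}$ iff there is a $\tau$-morphism from $L^F$ to $L^{F'}$) they form a lattice. The AE-subclasses of $\mathcal Q$ form a lattice under inclusion. The two lattices are dually isomorphic, via a map that sends the class of $L^F$ to $\mathcal Q\cap\mathrm{Mod}(e(F))$ and, in particular, the class of $L^\Sigma$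 to $\mathcal Q\cap\mathrm{Mod}(\Sigma)$ for each $\Sigma$ such that $\tau_\Sigma$ has a constant symbol only if $\tau$ has one. -/

import Mathlib

open FirstOrder.Language FirstOrder

universe u v

namespace AlgebraicExpansion

/-! ### Algebras, quasivarieties, EFD-sentences -/

/-- A (nonempty) algebra in the language `τ`. -/
structure Alg (τ : FirstOrder.Language.{u, v}) where
  carrier : Type u
  [str : τ.Structure carrier]
  [nonempty : Nonempty carrier]

attribute [instance] Alg.str Alg.nonempty

/-- An equation between terms with variables in `α`. -/
abbrev Eqn (τ : FirstOrder.Language.{u, v}) (α : Type) := τ.Term α × τ.Term α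

/-- The algebra `A` satisfies the equation `e` under the assignment `w`. -/
def Eqn.Sat {τ : FirstOrder.Language.{u, v}} {α : Type} (A : Alg τ) (w : α → A.carrier) (e : Eqn τ α) : Prop :=
  e.1.realize w = e.2.realize w

/-- A quasi-identity: a finite conjunction of equations implying an equation. -/
structure QuasiIdentity (τ : FirstOrder.Language.{u, v}) where
  premises : List (Eqn τ ℕ)
  conclusion : Eqn τ ℕ

/-- Validity of a quasi-identity in an algebra. -/
def QuasiIdentity.Holds {τ : FirstOrder.Language.{u, v}} (A : Alg τ) (q : QuasiIdentity τ) : Prop :=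
  ∀ w : ℕ → A.carrier, (∀ e ∈ q.premises, e.Sat A w) → q.conclusion.Sat A w

/-- A quasivariety is a class of algebras axiomatized by a set of quasi-identities. -/
def IsQuasivariety {τ : FirstOrder.Language.{u, v}} (K : Set (Alg τ)) : Prop :=
  ∃ Γ : Set (QuasiIdentity τ), K = {A | ∀ q ∈ Γ, q.Holds A}

/-- An EFD-sentence `∀ x₁ … xₙ ∃! z₁ … zₘ, ⋀ᵢ sᵢ(x, z) = tᵢ(x, z)` with `n ≥ 0`, `m ≥ 1`;
the variables `x` are `Sum.inl`, the variables `z` are `Sum.inr`. -/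
structure EFD (τ : FirstOrder.Language.{u, v}) where
  n : ℕ
  m : ℕ
  one_le_m : 1 ≤ m
  eqs : List (Eqn τ (Fin n ⊕ Fin m))

/-- Validity of an EFD-sentence in an algebra. -/
def EFD.Holds {τ : FirstOrder.Language.{u, v}} (A : Alg τ) (φ : EFD τ) : Prop :=
  ∀ x : Fin φ.n → A.carrier, ∃! z : Fin φ.m → A.carrier, ∀ e ∈ φ.eqs, e.Sat A (Sum.elim x z)

/-- `Mod(Σ)` for a set `Σ` of EFD-sentences. -/
def ModEFD {τ : FirstOrder.Language.{u, v}} (S : Set (EFD τ)) : Set (Alg τ) := {A | ∀ φ ∈ S, φ.Holds A}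

/-! ### Expansions of a language by new operation symbols -/

/-- For families of numbers `n i`, `m i`: new symbols `f^i_1, …, f^i_{m i}` of arity `n i`. -/
inductive NewFn {ι : Type u} (n m : ι → ℕ) : ℕ → Type u
  | mk (i : ι) (j : Fin (m i)) : NewFn n m (n i)

/-- The language of the new symbols. -/
def newLang {ι : Type u} (n m : ι → ℕ) : FirstOrder.Language.{u, v} := ⟨NewFn n m, fun _ => PEmpty⟩

instance {ι : Type u} (n m : ι → ℕ) : (newLang.{u, v} n m).IsAlgebraic :=
  fun _ => inferInstanceAs (IsEmpty PEmpty)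

/-- The expansion of `τ` by the new symbols. -/
abbrev addOps (τ : FirstOrder.Language.{u, v}) {ι : Type u} (n m : ι → ℕ) : FirstOrder.Language.{u, v} :=
  τ.sum (newLang.{u, v} n m)

/-- The inclusion of `τ` in its expansion. -/
abbrev incl (τ : FirstOrder.Language.{u, v}) {ι : Type u} (n m : ι → ℕ) : τ →ᴸ addOps τ n m := LHom.sumInl

/-- The new symbol `f^i_j`, as a symbol of the expanded language. -/
def newOp (τ : FirstOrder.Language.{u, v}) {ι : Type u} (n m : ι → ℕ) (i : ι) (j : Fin (m i)) :
    (addOps τ n m).Functions (n i) :=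
  Sum.inr (NewFn.mk i j)

/-- The `τ`-reduct of an algebra in a language that expands `τ`. -/
def Alg.reduct {τ τ₁ : FirstOrder.Language.{u, v}} (h : τ →ᴸ τ₁) (A : Alg τ₁) : Alg τ where
  carrier := A.carrier
  str := h.reduct A.carrier
  nonempty := A.nonempty

/-- The language `τ_Σ`: the symbols of `τ` and, for every `φ ∈ Σ`, new symbols `f^φ_1, …, f^φ_m` of
arity `n`. -/
abbrev EFD.lang {τ : FirstOrder.Language.{u, v}} (S : Set (EFD τ)) : FirstOrder.Language.{u, v} :=
  addOps τ (fun φ : S => φ.1.n) (fun φ : S => φ.1.m)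

/-- The inclusion of `τ` in `τ_Σ`. -/
abbrev EFD.incl {τ : FirstOrder.Language.{u, v}} (S : Set (EFD τ)) : τ →ᴸ EFD.lang S :=
  AlgebraicExpansion.incl τ (fun φ : S => φ.1.n) (fun φ : S => φ.1.m)

/-- The value `f^φ_j(x)` in a `τ_Σ`-algebra. -/
def EFD.opVal {τ : FirstOrder.Language.{u, v}} {S : Set (EFD τ)} (A : Alg (EFD.lang S)) (φ : S)
    (j : Fin φ.1.m) (x : Fin φ.1.n → A.carrier) : A.carrier :=
  Structure.funMap (newOp τ (fun φ : S => φ.1.n) (fun φ : S => φ.1.m) φ j) x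

/-- The algebraic expansion `Q^Σ` of `Q`: the `τ_Σ`-algebras whose `τ`-reduct is in `Q` and that
satisfy, for every `φ ∈ Σ`, the identities `E_φ` and the quasi-identities `U(φ)`. -/
def classExpansion {τ : FirstOrder.Language.{u, v}} (Q : Set (Alg τ)) (S : Set (EFD τ)) :
    Set (Alg (EFD.lang S)) :=
  {A | A.reduct (EFD.incl S) ∈ Q ∧ ∀ φ : S,
    (∀ x : Fin φ.1.n → A.carrier, ∀ e ∈ φ.1.eqs,
      e.Sat (A.reduct (EFD.incl S)) (Sum.elim x fun j => EFD.opVal A φ j x)) ∧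
    (∀ (x : Fin φ.1.n → A.carrier) (y z : Fin φ.1.m → A.carrier),
      (∀ e ∈ φ.1.eqs, e.Sat (A.reduct (EFD.incl S)) (Sum.elim x y)) →
      (∀ e ∈ φ.1.eqs, e.Sat (A.reduct (EFD.incl S)) (Sum.elim x z)) → y = z)}

/-! ### Logics and algebraizability -/

/-- The terms (formulas) of `τ` over a fixed countably infinite set of variables. -/
abbrev Tm (τ : FirstOrder.Language.{u, v}) := τ.Term ℕ

/-- A sentential logic: a finitary structural consequence relation on `Tm τ`; the corresponding
consequence operator is `Γ ↦ {φ | Γ ⊢ φ}`. -/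
structure SententialLogic (τ : FirstOrder.Language.{u, v}) where
  Entails : Set (Tm τ) → Tm τ → Prop
  refl : ∀ {Γ φ}, φ ∈ Γ → Entails Γ φ
  mono : ∀ {Γ Γ' φ}, Γ ⊆ Γ' → Entails Γ φ → Entails Γ' φ
  cut : ∀ {Γ Γ' φ}, (∀ ψ ∈ Γ', Entails Γ ψ) → Entails Γ' φ → Entails Γ φ
  structural : ∀ {Γ φ} (σ : ℕ → Tm τ), Entails Γ φ →
    Entails ((fun ψ => ψ.subst σ) '' Γ) (φ.subst σ)
  finitary : ∀ {Γ φ}, Entails Γ φ → ∃ Γ₀ ⊆ Γ, Γ₀.Finite ∧ Entails Γ₀ φ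

/-- `Δ(s, t)` for a set of formulas `Δ(x, y)` in two variables. -/
def equivForms {τ : FirstOrder.Language.{u, v}} {α : Type} (Δ : Finset (τ.Term (Fin 2))) (e : Eqn τ α) :
    Set (τ.Term α) :=
  {φ | ∃ δ ∈ Δ, φ = δ.subst ![e.1, e.2]}

/-- `ε(φ)` for a set of equations `ε(x)` in one variable. -/
def defEqns {τ : FirstOrder.Language.{u, v}} {α : Type} (ε : Set (Eqn τ (Fin 1))) (φ : τ.Term α) :
    Set (Eqn τ α) :=
  {e | ∃ d ∈ ε, e = (d.1.subst fun _ => φ, d.2.subst fun _ => φ)}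

/-- The equational consequence relation of a class `K` of algebras. -/
def EqConseq {τ : FirstOrder.Language.{u, v}} (K : Set (Alg τ)) (Θ : Set (Eqn τ ℕ)) (e : Eqn τ ℕ) : Prop :=
  ∀ A ∈ K, ∀ w : ℕ → A.carrier, (∀ d ∈ Θ, d.Sat A w) → e.Sat A w

/-- `L` is algebraized by `K` via the finite set `Δ(x, y)` of equivalence formulas and the set
`ε(x)` of defining equations. -/
structure Algebraizes {τ : FirstOrder.Language.{u, v}} (L : SententialLogic τ) (K : Set (Alg τ))
    (Δ : Finset (τ.Term (Fin 2))) (ε : Set (Eqn τ (Fin 1))) : Prop where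
  alg1 : ∀ Γ φ, L.Entails Γ φ ↔
    ∀ e ∈ defEqns ε φ, EqConseq K (⋃ ψ ∈ Γ, defEqns ε ψ) e
  alg2 : ∀ Θ e, EqConseq K Θ e ↔
    ∀ φ ∈ equivForms Δ e, L.Entails (⋃ d ∈ Θ, equivForms Δ d) φ
  alg3 : ∀ φ : Tm τ,
    (∀ ψ ∈ ⋃ e ∈ defEqns ε φ, equivForms Δ e, L.Entails {φ} ψ) ∧
    L.Entails (⋃ e ∈ defEqns ε φ, equivForms Δ e) φ
  alg4 : ∀ e : Eqn τ ℕ,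
    (∀ d ∈ ⋃ φ ∈ equivForms Δ e, defEqns ε φ, EqConseq K {e} d) ∧
    EqConseq K (⋃ φ ∈ equivForms Δ e, defEqns ε φ) e

/-! ### Algebraic expansions of a logic -/

/-- A finite set `Φ(x₁ … xₙ, z₁ … zₘ)` of formulas, `n, m ≥ 0`. -/
structure FormSet (τ : FirstOrder.Language.{u, v}) where
  n : ℕ
  m : ℕ
  forms : Set (τ.Term (Fin n ⊕ Fin m))
  finite : forms.Finite

/-- `A ⊨ e(Φ)`, where `e(Φ)` is `∀ x ∃! z ⋀ ε(Φ(x, z))`. -/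
def FormSet.Holds {τ : FirstOrder.Language.{u, v}} (ε : Set (Eqn τ (Fin 1))) (A : Alg τ) (Φ : FormSet τ) :
    Prop :=
  ∀ x : Fin Φ.n → A.carrier, ∃! z : Fin Φ.m → A.carrier,
    ∀ φ ∈ Φ.forms, ∀ e ∈ defEqns ε φ, e.Sat A (Sum.elim x z)

theorem finite_equivForms {τ : FirstOrder.Language.{u, v}} {α : Type} (Δ : Finset (τ.Term (Fin 2)))
    (e : Eqn τ α) : (equivForms Δ e).Finite := by
  refine (Δ.finite_toSet.image fun δ => δ.subst ![e.1, e.2]).subset ?_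
  rintro φ ⟨δ, hδ, rfl⟩
  exact ⟨δ, hδ, rfl⟩

/-- The finite set of formulas `d(φ) = Δ(α(x, z))` of an EFD-sentence `φ = ∀ x ∃! z α(x, z)`. -/
def EFD.toFormSet {τ : FirstOrder.Language.{u, v}} (Δ : Finset (τ.Term (Fin 2))) (φ : EFD τ) :
    FormSet τ where
  n := φ.n
  m := φ.m
  forms := ⋃ e ∈ {e | e ∈ φ.eqs}, equivForms Δ e
  finite := (List.finite_toSet φ.eqs).biUnion fun e _ => finite_equivForms Δ e

/-- The terms `φ(a, b)` over the expanded language. -/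
def plug {τ τ₁ : FirstOrder.Language.{u, v}} (h : τ →ᴸ τ₁) {n m : ℕ} (φ : τ.Term (Fin n ⊕ Fin m))
    (a : Fin n → Tm τ₁) (b : Fin m → Tm τ₁) : Tm τ₁ :=
  (h.onTerm φ).subst (Sum.elim a b)

/-- Derivability from `Γ` by means of the (substitution instances of the) rules of `L`, the axioms
`(E_Φ)`: `⊢ Φ(x, f^Φ(x))`, and the rules `(U_Φ)`: `Φ(x, y), Φ(x, z) ⊢ Δ(y, z)`, for every `Φ` in
the family `F`. -/
inductive Derives {τ : FirstOrder.Language.{u, v}} (L : SententialLogic τ) (Δ : Finset (τ.Term (Fin 2)))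
    {ι : Type u} (F : ι → FormSet τ) (Γ : Set (Tm (addOps τ (fun i => (F i).n) fun i => (F i).m))) :
    Tm (addOps τ (fun i => (F i).n) fun i => (F i).m) → Prop
  | hyp {φ} (h : φ ∈ Γ) : Derives L Δ F Γ φ
  | base {Γ₀ : Set (Tm τ)} {φ : Tm τ} (h : L.Entails Γ₀ φ)
      (σ : ℕ → Tm (addOps τ (fun i => (F i).n) fun i => (F i).m))
      (hd : ∀ ψ ∈ Γ₀, Derives L Δ F Γ (((incl τ _ _).onTerm ψ).subst σ)) :
      Derives L Δ F Γ (((incl τ _ _).onTerm φ).subst σ)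
  | exist (i : ι) {φ : τ.Term (Fin (F i).n ⊕ Fin (F i).m)} (h : φ ∈ (F i).forms)
      (a : Fin (F i).n → Tm (addOps τ (fun i => (F i).n) fun i => (F i).m)) :
      Derives L Δ F Γ (plug (incl τ _ _) φ a fun j => Term.func (newOp τ _ _ i j) a)
  | unique (i : ι) (a : Fin (F i).n → Tm (addOps τ (fun i => (F i).n) fun i => (F i).m))
      (b c : Fin (F i).m → Tm (addOps τ (fun i => (F i).n) fun i => (F i).m))
      (hb : ∀ φ ∈ (F i).forms, Derives L Δ F Γ (plug (incl τ _ _) φ a b))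
      (hc : ∀ φ ∈ (F i).forms, Derives L Δ F Γ (plug (incl τ _ _) φ a c))
      (j : Fin (F i).m) {δ : τ.Term (Fin 2)} (hδ : δ ∈ Δ) :
      Derives L Δ F Γ (((incl τ _ _).onTerm δ).subst ![b j, c j])

theorem subst_subst {τ : FirstOrder.Language.{u, v}} {α β γ : Type} (t : τ.Term α) (f : α → τ.Term β)
    (g : β → τ.Term γ) : (t.subst f).subst g = t.subst fun a => (f a).subst g := by
  induction t with
  | var a => rfl
  | func F ts ih => simp only [Term.subst, ih]

section Derives

variable {τ : FirstOrder.Language.{u, v}} {L : SententialLogic τ} {Δ : Finset (τ.Term (Fin 2))}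
  {ι : Type u} {F : ι → FormSet τ}

theorem Derives.cut {Γ Γ' : Set (Tm (addOps τ (fun i => (F i).n) fun i => (F i).m))} {φ}
    (h : ∀ ψ ∈ Γ', Derives L Δ F Γ ψ) (hφ : Derives L Δ F Γ' φ) : Derives L Δ F Γ φ := by
  induction hφ with
  | hyp h' => exact h _ h'
  | base h' σ _ ih => exact .base h' σ ih
  | exist i h' a => exact .exist i h' a
  | unique i a b c _ _ j hδ ihb ihc => exact .unique i a b c ihb ihc j hδ

theorem Derives.mono {Γ Γ' : Set (Tm (addOps τ (fun i => (F i).n) fun i => (F i).m))} {φ}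
    (h : Γ ⊆ Γ') (hφ : Derives L Δ F Γ φ) : Derives L Δ F Γ' φ :=
  Derives.cut (fun _ hψ => .hyp (h hψ)) hφ

theorem plug_subst {τ₁ : FirstOrder.Language.{u, v}} (h : τ →ᴸ τ₁) {n m : ℕ} (φ : τ.Term (Fin n ⊕ Fin m))
    (a : Fin n → Tm τ₁) (b : Fin m → Tm τ₁) (σ : ℕ → Tm τ₁) :
    (plug h φ a b).subst σ = plug h φ (fun i => (a i).subst σ) fun j => (b j).subst σ := by
  unfold plug
  rw [subst_subst]
  congr 1
  funext x
  cases x <;> rfl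

theorem Derives.structural {Γ : Set (Tm (addOps τ (fun i => (F i).n) fun i => (F i).m))} {φ}
    (σ : ℕ → Tm (addOps τ (fun i => (F i).n) fun i => (F i).m)) (hφ : Derives L Δ F Γ φ) :
    Derives L Δ F ((fun ψ => ψ.subst σ) '' Γ) (φ.subst σ) := by
  induction hφ with
  | hyp h' => exact .hyp ⟨_, h', rfl⟩
  | base h' σ' _ ih =>
    rw [subst_subst]
    refine .base h' _ fun ψ hψ => ?_
    have := ih ψ hψ
    rwa [subst_subst] at this
  | exist i h' a =>
    rw [plug_subst]
    exact .exist i h' fun k => (a k).subst σ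
  | unique i a b c _ _ j hδ ihb ihc =>
    rw [subst_subst]
    have key := Derives.unique (L := L) (Δ := Δ) (F := F)
      (Γ := (fun ψ => ψ.subst σ) '' Γ) i (fun k => (a k).subst σ)
      (fun k => (b k).subst σ) (fun k => (c k).subst σ)
      (fun φ hφ => by rw [← plug_subst]; exact ihb φ hφ)
      (fun φ hφ => by rw [← plug_subst]; exact ihc φ hφ) j hδ
    convert key using 2
    funext k
    fin_cases k <;> rfl

theorem Derives.finitary {Γ : Set (Tm (addOps τ (fun i => (F i).n) fun i => (F i).m))} {φ}
    (hφ : Derives L Δ F Γ φ) : ∃ Γ₀ ⊆ Γ, Γ₀.Finite ∧ Derives L Δ F Γ₀ φ := by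
  induction hφ with
  | @hyp φ h' =>
    exact ⟨{φ}, Set.singleton_subset_iff.2 h', Set.finite_singleton φ, .hyp rfl⟩
  | base h' σ _ ih =>
    obtain ⟨G, hG, hfin, hent⟩ := L.finitary h'
    choose! g hg hgf hgd using ih
    refine ⟨⋃ ψ ∈ G, g ψ, Set.iUnion₂_subset fun ψ hψ => hg ψ (hG hψ),
      hfin.biUnion fun ψ hψ => hgf ψ (hG hψ), .base hent σ fun ψ hψ => ?_⟩
    exact (hgd ψ (hG hψ)).mono (Set.subset_biUnion_of_mem (u := g) hψ)
  | exist i h' a => exact ⟨∅, Set.empty_subset _, Set.finite_empty, .exist i h' a⟩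
  | unique i a b c _ _ j hδ ihb ihc =>
    choose! g hg hgf hgd using ihb
    choose! k hk hkf hkd using ihc
    refine ⟨(⋃ ψ ∈ (F i).forms, g ψ) ∪ ⋃ ψ ∈ (F i).forms, k ψ,
      Set.union_subset (Set.iUnion₂_subset hg) (Set.iUnion₂_subset hk),
      ((F i).finite.biUnion hgf).union ((F i).finite.biUnion hkf),
      .unique i a b c (fun φ hφ => ?_) (fun φ hφ => ?_) j hδ⟩
    · exact (hgd φ hφ).mono
        ((Set.subset_biUnion_of_mem (u := g) hφ).trans Set.subset_union_left)
    · exact (hkd φ hφ).mono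
        ((Set.subset_biUnion_of_mem (u := k) hφ).trans Set.subset_union_right)

end Derives

/-- The algebraic expansion of `L` by a family `F` of finite sets of formulas: the least logic that
contains `L` and the axioms `(E_Φ)` and rules `(U_Φ)` for all `Φ` in the family. -/
def expansion {τ : FirstOrder.Language.{u, v}} (L : SententialLogic τ) (Δ : Finset (τ.Term (Fin 2)))
    {ι : Type u} (F : ι → FormSet τ) :
    SententialLogic (addOps τ (fun i => (F i).n) fun i => (F i).m) where
  Entails := Derives L Δ F
  refl := .hyp
  mono := Derives.mono
  cut := Derives.cut
  structural := Derives.structural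
  finitary := Derives.finitary

/-- The algebraic expansion `L^Σ` of `L` by a set `Σ` of EFD-sentences, in the language `τ_Σ`: the
expansion by the sets of formulas `d(φ)`, `φ ∈ Σ`. -/
def logicExpansion {τ : FirstOrder.Language.{u, v}} (L : SententialLogic τ) (Δ : Finset (τ.Term (Fin 2)))
    (S : Set (EFD τ)) : SententialLogic (EFD.lang S) :=
  expansion L Δ fun φ : S => φ.1.toFormSet Δ

/-! ### Translations, interpretations, morphisms -/

/-- A `τ`-translation from `τ₁` into `τ₂`, two expansions of `τ`. -/
structure Translation {τ τ₁ τ₂ : FirstOrder.Language.{u, v}} (h₁ : τ →ᴸ τ₁) (h₂ : τ →ᴸ τ₂) where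
  toFun : ∀ {n : ℕ}, τ₁.Functions n → τ₂.Term (Fin n)
  fixes : ∀ {n : ℕ} (f : τ.Functions n),
    toFun (h₁.onFunction f) = Term.func (h₂.onFunction f) Term.var

section Translation

variable {τ τ₁ τ₂ τ₃ : FirstOrder.Language.{u, v}} {h₁ : τ →ᴸ τ₁} {h₂ : τ →ᴸ τ₂} {h₃ : τ →ᴸ τ₃}

/-- The extension of a translation to terms. -/
def Translation.onTerm (T : Translation h₁ h₂) {α : Type} : τ₁.Term α → τ₂.Term α
  | .var a => .var a
  | .func f ts => (T.toFun f).subst fun i => T.onTerm (ts i)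

/-- The algebra `A^T`. -/
def Alg.interp [τ₁.IsAlgebraic] (T : Translation h₁ h₂) (A : Alg τ₂) : Alg τ₁ where
  carrier := A.carrier
  str := { funMap := fun f x => (T.toFun f).realize x, RelMap := fun r => isEmptyElim r }
  nonempty := A.nonempty

/-- `T` is a `τ`-interpretation of `K₁` in `K₂`. -/
def Translation.IsInterpretation [τ₁.IsAlgebraic] (T : Translation h₁ h₂) (K₁ : Set (Alg τ₁))
    (K₂ : Set (Alg τ₂)) : Prop :=
  ∀ A ∈ K₂, A.interp T ∈ K₁

/-- `T` is a `τ`-morphism from `L₁` to `L₂`. -/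
def Translation.IsMorphism (T : Translation h₁ h₂) (L₁ : SententialLogic τ₁)
    (L₂ : SententialLogic τ₂) : Prop :=
  ∀ Γ φ, L₁.Entails Γ φ → L₂.Entails (T.onTerm '' Γ) (T.onTerm φ)

variable (h₁ h₂) in
/-- `τ`-term-equivalence of two classes of algebras. -/
def TermEquivalent [τ₁.IsAlgebraic] [τ₂.IsAlgebraic] (K₁ : Set (Alg τ₁)) (K₂ : Set (Alg τ₂)) :
    Prop :=
  ∃ (T : Translation h₁ h₂) (S : Translation h₂ h₁),
    T.IsInterpretation K₁ K₂ ∧ S.IsInterpretation K₂ K₁ ∧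
    (∀ A ∈ K₂, (A.interp T).interp S = A) ∧ (∀ A ∈ K₁, (A.interp S).interp T = A)

/-- Interderivability of two formulas in a logic. -/
def SententialLogic.Interderivable (L : SententialLogic τ) (φ ψ : Tm τ) : Prop :=
  L.Entails {φ} ψ ∧ L.Entails {ψ} φ

variable (h₁ h₂) in
/-- `τ`-equipollence of two logics. -/
def Equipollent (L₁ : SententialLogic τ₁) (L₂ : SententialLogic τ₂) : Prop :=
  ∃ (T : Translation h₁ h₂) (S : Translation h₂ h₁),
    T.IsMorphism L₁ L₂ ∧ S.IsMorphism L₂ L₁ ∧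
    (∀ φ, L₁.Interderivable φ (S.onTerm (T.onTerm φ))) ∧
    (∀ φ, L₂.Interderivable φ (T.onTerm (S.onTerm φ)))

/-- The identity translation. -/
def Translation.id (h₁ : τ →ᴸ τ₁) : Translation h₁ h₁ where
  toFun f := Term.func f Term.var
  fixes _ := rfl

theorem Translation.id_onTerm {α : Type} (t : τ₁.Term α) : (Translation.id h₁).onTerm t = t := by
  induction t with
  | var a => rfl
  | func f ts ih => simp only [Translation.onTerm, ih]; rfl

theorem Translation.onTerm_subst (T : Translation h₁ h₂) {α β : Type} (t : τ₁.Term α)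
    (σ : α → τ₁.Term β) : T.onTerm (t.subst σ) = (T.onTerm t).subst fun a => T.onTerm (σ a) := by
  induction t with
  | var a => rfl
  | func f ts ih => simp only [Term.subst, Translation.onTerm, ih, subst_subst]

/-- The composition of two translations. -/
def Translation.comp (T' : Translation h₂ h₃) (T : Translation h₁ h₂) : Translation h₁ h₃ where
  toFun f := T'.onTerm (T.toFun f)
  fixes f := by
    rw [T.fixes]
    simp only [Translation.onTerm, T'.fixes, Term.subst]

theorem Translation.comp_onTerm (T' : Translation h₂ h₃) (T : Translation h₁ h₂) {α : Type}
    (t : τ₁.Term α) : (T'.comp T).onTerm t = T'.onTerm (T.onTerm t) := by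
  induction t with
  | var a => rfl
  | func f ts ih =>
    simp only [Translation.onTerm, ih, Translation.onTerm_subst]
    rfl

theorem Translation.IsMorphism.id (L₁ : SententialLogic τ₁) :
    (Translation.id h₁).IsMorphism L₁ L₁ := by
  intro Γ φ h
  have e : (Translation.id h₁).onTerm (α := ℕ) = fun t => t :=
    funext fun t => Translation.id_onTerm t
  rw [e, Set.image_id']
  exact h

theorem Translation.IsMorphism.comp {L₁ : SententialLogic τ₁} {L₂ : SententialLogic τ₂}
    {L₃ : SententialLogic τ₃} {T' : Translation h₂ h₃} {T : Translation h₁ h₂}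
    (hT' : T'.IsMorphism L₂ L₃) (hT : T.IsMorphism L₁ L₂) : (T'.comp T).IsMorphism L₁ L₃ := by
  intro Γ φ h
  have e : (T'.comp T).onTerm (α := ℕ) = fun t => T'.onTerm (T.onTerm t) :=
    funext fun t => Translation.comp_onTerm T' T t
  have := hT' _ _ (hT _ _ h)
  rw [Set.image_image] at this
  rw [e]
  exact this

theorem SententialLogic.Interderivable.trans {L : SententialLogic τ} {φ ψ χ : Tm τ}
    (h : L.Interderivable φ ψ) (h' : L.Interderivable ψ χ) : L.Interderivable φ χ :=
  ⟨L.cut (by rintro _ rfl; exact h.1) h'.1, L.cut (by rintro _ rfl; exact h'.2) h.2⟩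

theorem Translation.IsMorphism.interderivable {L₁ : SententialLogic τ₁} {L₂ : SententialLogic τ₂}
    {T : Translation h₁ h₂} (hT : T.IsMorphism L₁ L₂) {φ ψ : Tm τ₁}
    (h : L₁.Interderivable φ ψ) : L₂.Interderivable (T.onTerm φ) (T.onTerm ψ) := by
  have a := hT _ _ h.1
  have b := hT _ _ h.2
  rw [Set.image_singleton] at a b
  exact ⟨a, b⟩

theorem Equipollent.refl (L₁ : SententialLogic τ₁) : Equipollent h₁ h₁ L₁ L₁ :=
  ⟨.id h₁, .id h₁, .id L₁, .id L₁,
    fun φ => by simp only [Translation.id_onTerm]; exact ⟨L₁.refl rfl, L₁.refl rfl⟩,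
    fun φ => by simp only [Translation.id_onTerm]; exact ⟨L₁.refl rfl, L₁.refl rfl⟩⟩

theorem Equipollent.symm {L₁ : SententialLogic τ₁} {L₂ : SententialLogic τ₂}
    (h : Equipollent h₁ h₂ L₁ L₂) : Equipollent h₂ h₁ L₂ L₁ := by
  obtain ⟨T, S, hT, hS, a, b⟩ := h
  exact ⟨S, T, hS, hT, b, a⟩

theorem Equipollent.trans {L₁ : SententialLogic τ₁} {L₂ : SententialLogic τ₂}
    {L₃ : SententialLogic τ₃} (h : Equipollent h₁ h₂ L₁ L₂) (h' : Equipollent h₂ h₃ L₂ L₃) :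
    Equipollent h₁ h₃ L₁ L₃ := by
  obtain ⟨T, S, hT, hS, a, b⟩ := h
  obtain ⟨T', S', hT', hS', a', b'⟩ := h'
  refine ⟨T'.comp T, S.comp S', hT'.comp hT, hS.comp hS', fun φ => ?_, fun φ => ?_⟩
  · simp only [Translation.comp_onTerm]
    exact (a φ).trans (hS.interderivable (a' _))
  · simp only [Translation.comp_onTerm]
    exact (b' φ).trans (hT'.interderivable (b _))

end Translation

/-! ### The two ordered sets -/

/-- The AE-subclasses of `Q`. -/
structure AESubclass {τ : FirstOrder.Language.{u, v}} (Q : Set (Alg τ)) where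
  cls : Set (Alg τ)
  isAE : ∃ S : Set (EFD τ), cls = Q ∩ ModEFD S

/-- A presentation of an algebraic expansion: a family of finite sets of `τ`-formulas that
introduces a new constant symbol (that is, has a member with `n = 0 < m`) only if `τ` has a
constant symbol. -/
structure Presentation (τ : FirstOrder.Language.{u, v}) where
  ι : Type u
  F : ι → FormSet τ
  const : Nonempty ((addOps τ (fun i => (F i).n) fun i => (F i).m).Functions 0) →
    Nonempty (τ.Functions 0)

/-- The presentation of `L^Σ`. -/
def EFD.presentation {τ : FirstOrder.Language.{u, v}} (Δ : Finset (τ.Term (Fin 2))) (S : Set (EFD τ))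
    (hS : Nonempty ((EFD.lang S).Functions 0) → Nonempty (τ.Functions 0)) : Presentation τ :=
  ⟨S, fun φ => φ.1.toFormSet Δ, hS⟩

/-- There is a `τ`-morphism from the expansion of `L` presented by `P` to the one presented by
`P'`. -/
def Presentation.Le {τ : FirstOrder.Language.{u, v}} (L : SententialLogic τ) (Δ : Finset (τ.Term (Fin 2)))
    (P P' : Presentation τ) : Prop :=
  ∃ T : Translation (incl τ (fun i => (P.F i).n) fun i => (P.F i).m)
      (incl τ (fun i => (P'.F i).n) fun i => (P'.F i).m),
    T.IsMorphism (expansion L Δ P.F) (expansion L Δ P'.F)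

/-- Two presentations are equivalent if the expansions of `L` are `τ`-equipollent. -/
def equipollence {τ : FirstOrder.Language.{u, v}} (L : SententialLogic τ) (Δ : Finset (τ.Term (Fin 2))) :
    Setoid (Presentation τ) where
  r P P' := Equipollent (incl τ (fun i => (P.F i).n) fun i => (P.F i).m)
    (incl τ (fun i => (P'.F i).n) fun i => (P'.F i).m) (expansion L Δ P.F) (expansion L Δ P'.F)
  iseqv := ⟨fun _ => .refl _, .symm, .trans⟩

/-- The algebraic expansions of `L` modulo `τ`-equipollence. -/
def Expansions {τ : FirstOrder.Language.{u, v}} (L : SententialLogic τ) (Δ : Finset (τ.Term (Fin 2))) :=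
  Quotient (equipollence L Δ)

/-- The class of an algebraic expansion modulo `τ`-equipollence. -/
def Expansions.mk {τ : FirstOrder.Language.{u, v}} (L : SententialLogic τ) (Δ : Finset (τ.Term (Fin 2)))
    (P : Presentation τ) : Expansions L Δ :=
  Quotient.mk (equipollence L Δ) P

/-- The order on the expansions modulo equipollence given by the existence of `τ`-morphisms. -/
def Expansions.Le {τ : FirstOrder.Language.{u, v}} {L : SententialLogic τ} {Δ : Finset (τ.Term (Fin 2))}
    (E E' : Expansions L Δ) : Prop :=
  Quotient.liftOn₂ E E' (Presentation.Le L Δ) (by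
    rintro P₁ P₂ P₁' P₂' ⟨T, S, hT, hS, -⟩ ⟨T', S', hT', hS', -⟩
    apply propext
    constructor
    · rintro ⟨R, hR⟩
      exact ⟨(T'.comp R).comp S, (hT'.comp hR).comp hS⟩
    · rintro ⟨R, hR⟩
      exact ⟨(S'.comp R).comp T, (hS'.comp hR).comp hT⟩)

end AlgebraicExpansion

open AlgebraicExpansion

/-!
The proof works with an arbitrary family `F` of finite sets `Φ(x, z)` of formulas instead of a set
`Σ` of EFD-sentences, and compares the expansion `expansion L Δ F` with the class `famClass ε Q F`
of `τ_F`-algebras over `Q` whose new operations name the unique solutions of the conditions `e(Φ)`.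
For the sets `d(φ)` of EFD-sentences this class is `Q^Σ` (`famClass_toFormSet`).

An element of an algebra is *designated* if it satisfies the defining equations. Entailment in `L`
is preservation of designated elements in `Q`, and two elements `a`, `b` are equal iff `Δ(a, b)` is
designated. The same holds for the expansion and `famClass ε Q F` (`derives_iff`): soundness is an
induction on derivations, and completeness uses the Lindenbaum–Tarski algebra of a theory, whose
elements are the formulas modulo derivability of `Δ(s, t)`. This algebra belongs to
`famClass ε Q F` (`lindAlg_mem`). So `τ`-morphisms and `τ`-interpretations are the same
translations (`exists_isMorphism_iff`).

An algebra in `Q` that satisfies the conditions `e(Φ)` has an expansion in `famClass ε Q F`, and an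
interpretation preserves the `τ`-reduct; hence interpretations yield inclusions of the classes
`famMod ε Q F` of `τ`-reducts. Conversely, if `famMod ε Q F ⊆ famMod ε Q F'`, then a condition of
`F'` can be solved at distinct variables in the Lindenbaum–Tarski algebra of the theorems of the
expansion by `F`. The solution consists of terms, and after superfluous variables are replaced by
one of `x₁, …, xₙ`, or by a constant if `n = 0`, these terms translate the new symbols
(`exists_terms`).

The members of `famClass ε Q F` are determined by their `τ`-reducts (`famClass_ext`). Therefore two
interpretations in opposite directions are automatically mutually inverse, so that equipollence and
term-equivalence only require translations in both directions (`termEquivalent_iff`).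

For the lattices, each condition `e(Φ)` is equivalent over `Q` to an EFD-sentence, because finitely
many defining equations suffice (`Algebraizes.exists_finite_defEqns`). The sentence can be chosen
with at least one universal quantifier (`exists_efd`), so every AE-subclass comes from an expansion
without new constant symbols. Thus `F ↦ famMod ε Q F` induces an order-reversing bijection onto the
AE-subclasses, which are closed under intersection and form a lattice.
-/

namespace AlgebraicExpansion

variable {τ τ₁ τ₂ : FirstOrder.Language.{u, v}}

/-! ### Terms, reducts and interpreted algebras -/

/-- Two algebras on the same universe are equal if the operations agree. -/
theorem Alg.mk_congr [τ.IsAlgebraic] {M : Type u} [Nonempty M] {s s' : τ.Structure M}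
    (h : ∀ (n : ℕ) (f : τ.Functions n) (x : Fin n → M), s.funMap f x = s'.funMap f x) :
    @Alg.mk τ M s _ = @Alg.mk τ M s' _ := by
  have : s = s' := Structure.ext (by funext n f x; exact h n f x)
    (by funext n r; exact isEmptyElim r)
  subst this
  rfl

theorem Alg.str_eq_of_mk_eq {A : Alg τ} {s : τ.Structure A.carrier}
    (h : @Alg.mk _ A.carrier s A.nonempty = A) : s = A.str := by
  cases A
  simpa using h

theorem onTerm_subst {h : τ →ᴸ τ₁} {α β : Type} (t : τ.Term α) (σ : α → τ.Term β) :
    h.onTerm (t.subst σ) = (h.onTerm t).subst fun a => h.onTerm (σ a) := by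
  induction t with
  | var a => rfl
  | func f ts ih => simp only [Term.subst, LHom.onTerm, ih]

theorem onTerm_relabel_subst {h : τ →ᴸ τ₁} {α β γ : Type} (t : τ.Term α) (g : α → β)
    (σ : β → τ₁.Term γ) :
    (h.onTerm (t.relabel g)).subst σ = (h.onTerm t).subst (σ ∘ g) := by
  induction t with
  | var a => rfl
  | func f ts ih => simp only [Term.subst, LHom.onTerm, Term.relabel, ih]

/-- A `τ`-term has the same value in the reduct as in the algebra. -/
theorem realize_reduct (h : τ →ᴸ τ₁) (A : Alg τ₁) {α : Type} (t : τ.Term α)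
    (w : α → A.carrier) :
    Term.realize (M := (A.reduct h).carrier) w t =
      Term.realize (M := A.carrier) w (h.onTerm t) := by
  induction t with
  | var a => rfl
  | func f ts ih =>
    exact congrArg (fun x : Fin _ → A.carrier => Structure.funMap (h.onFunction f) x) (funext ih)

theorem Translation.onTerm_onTerm {h₁ : τ →ᴸ τ₁} {h₂ : τ →ᴸ τ₂} (T : Translation h₁ h₂) {α : Type}
    (t : τ.Term α) : T.onTerm (h₁.onTerm t) = h₂.onTerm t := by
  induction t with
  | var a => rfl
  | func f ts ih => simp only [LHom.onTerm, Translation.onTerm, T.fixes, Term.subst, ih]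

theorem realize_interp [τ₁.IsAlgebraic] {h₁ : τ →ᴸ τ₁} {h₂ : τ →ᴸ τ₂} (T : Translation h₁ h₂)
    (A : Alg τ₂) {α : Type} (t : τ₁.Term α) (w : α → A.carrier) :
    Term.realize (M := (A.interp T).carrier) w t =
      Term.realize (M := A.carrier) w (T.onTerm t) := by
  induction t with
  | var a => rfl
  | func f ts ih =>
    rw [Translation.onTerm, Term.realize_subst]
    exact congrArg (fun x : Fin _ → A.carrier => (T.toFun f).realize x) (funext ih)

theorem reduct_interp [τ.IsAlgebraic] [τ₁.IsAlgebraic] {h₁ : τ →ᴸ τ₁} {h₂ : τ →ᴸ τ₂}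
    (T : Translation h₁ h₂) (A : Alg τ₂) : (A.interp T).reduct h₁ = A.reduct h₂ := by
  refine Alg.mk_congr (M := A.carrier) fun n f x => ?_
  change (T.toFun (h₁.onFunction f)).realize x = Structure.funMap (h₂.onFunction f) x
  rw [T.fixes]
  rfl

/-- Every valuation of countably many variables extends along the encoding in `ℕ`. -/
theorem exists_valuation {α M : Type*} [Encodable α] [Nonempty M] (v : α → M) :
    ∃ w : ℕ → M, ∀ a, w (Encodable.encode a) = v a :=
  ⟨fun k => ((Encodable.decode k : Option α).map v).getD (Classical.arbitrary M), fun a => by simp⟩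

/-! ### Designated elements -/

/-- The element `a` of `A` satisfies the defining equations `ε`. -/
def Designated (ε : Set (Eqn τ (Fin 1))) (A : Alg τ) (a : A.carrier) : Prop :=
  ∀ d ∈ ε, d.Sat A fun _ => a

variable {ε : Set (Eqn τ (Fin 1))}

theorem forall_defEqns {α : Type} {A : Alg τ} {φ : τ.Term α} {w : α → A.carrier} :
    (∀ e ∈ defEqns ε φ, e.Sat A w) ↔ Designated ε A (φ.realize w) := by
  constructor
  · intro h d hd
    have := h _ ⟨d, hd, rfl⟩
    simpa only [Eqn.Sat, Term.realize_subst] using this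
  · rintro h _ ⟨d, hd, rfl⟩
    have := h d hd
    simpa only [Eqn.Sat, Term.realize_subst] using this

section Algebraizes

variable {L : SententialLogic τ} {Q : Set (Alg τ)} {Δ : Finset (τ.Term (Fin 2))}

/-- Consequence in `L` is preservation of designated elements in the algebras of `Q`. -/
theorem Algebraizes.entails_iff (hL : Algebraizes L Q Δ ε) {Γ : Set (Tm τ)} {φ : Tm τ} :
    L.Entails Γ φ ↔ ∀ A ∈ Q, ∀ w : ℕ → A.carrier, (∀ ψ ∈ Γ, Designated ε A (ψ.realize w)) →
      Designated ε A (φ.realize w) := by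
  rw [hL.alg1]
  constructor
  · intro h A hA w hw
    refine forall_defEqns.1 fun e he => h e he A hA w fun d hd => ?_
    simp only [Set.mem_iUnion] at hd
    obtain ⟨ψ, hψ, hd⟩ := hd
    exact forall_defEqns.2 (hw ψ hψ) d hd
  · intro h e he A hA w hw
    refine forall_defEqns.2 (h A hA w fun ψ hψ => forall_defEqns.1 fun d hd => hw d ?_) e he
    simp only [Set.mem_iUnion]
    exact ⟨ψ, hψ, hd⟩

/-- In the algebras of `Q`, two elements are equal iff `Δ` takes designated values at them. -/
theorem Algebraizes.designated_iff_eq (hL : Algebraizes L Q Δ ε) {A : Alg τ} (hA : A ∈ Q)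
    (a b : A.carrier) : (∀ δ ∈ Δ, Designated ε A (δ.realize ![a, b])) ↔ a = b := by
  let w : ℕ → A.carrier := fun k => if k = 0 then a else b
  obtain ⟨h₁, h₂⟩ := hL.alg4 (.var 0, .var 1)
  have key : ∀ δ : τ.Term (Fin 2),
      (δ.subst ![Term.var 0, Term.var 1]).realize w = δ.realize ![a, b] := by
    intro δ
    rw [Term.realize_subst]
    congr 1
    funext k
    fin_cases k <;> rfl
  constructor
  · intro h
    refine h₂ A hA w fun d hd => ?_
    simp only [Set.mem_iUnion] at hd
    obtain ⟨_, ⟨δ, hδ, rfl⟩, hd⟩ := hd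
    refine forall_defEqns.2 ?_ d hd
    rw [key]
    exact h δ hδ
  · rintro rfl δ hδ
    rw [← key, ← forall_defEqns]
    intro d hd
    refine h₁ d ?_ A hA w ?_
    · simp only [Set.mem_iUnion]
      exact ⟨_, ⟨δ, hδ, rfl⟩, hd⟩
    · rintro _ rfl
      simp [Eqn.Sat, w]

theorem Algebraizes.designated_equivForms (hL : Algebraizes L Q Δ ε) {A : Alg τ} (hA : A ∈ Q)
    {α : Type} (e : Eqn τ α) (w : α → A.carrier) :
    (∀ φ ∈ equivForms Δ e, Designated ε A (φ.realize w)) ↔ e.Sat A w := by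
  rw [Eqn.Sat, ← hL.designated_iff_eq hA]
  have key : ∀ δ : τ.Term (Fin 2), (δ.subst ![e.1, e.2]).realize w
      = δ.realize ![e.1.realize w, e.2.realize w] := by
    intro δ
    rw [Term.realize_subst]
    congr 1
    funext k
    fin_cases k <;> rfl
  constructor
  · intro h δ hδ
    rw [← key]
    exact h _ ⟨δ, hδ, rfl⟩
  · rintro h _ ⟨δ, hδ, rfl⟩
    rw [key]
    exact h δ hδ

/-- Finitely many of the defining equations suffice: they are found by applying finitarity of `L`
to the derivation of a variable `x` from `Δ(ε(x))`. -/
theorem Algebraizes.exists_finite_defEqns (hL : Algebraizes L Q Δ ε) :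
    ∃ ε₀ : Set (Eqn τ (Fin 1)), ε₀.Finite ∧
      ∀ A ∈ Q, ∀ a : A.carrier, Designated ε₀ A a ↔ Designated ε A a := by
  obtain ⟨Γ, hΓ, hfin, hent⟩ := L.finitary (hL.alg3 (.var 0)).2
  have : ∀ ψ ∈ Γ, ∃ d ∈ ε, ψ ∈ equivForms Δ
      (d.1.subst fun _ => (Term.var 0 : Tm τ), d.2.subst fun _ => (Term.var 0 : Tm τ)) := by
    intro ψ hψ
    have := hΓ hψ
    simp only [Set.mem_iUnion] at this
    obtain ⟨_, ⟨d, hd, rfl⟩, h⟩ := this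
    exact ⟨d, hd, h⟩
  choose! g hg hg' using this
  refine ⟨g '' Γ, hfin.image g, fun A hA a => ⟨fun h => ?_, fun h d hd => ?_⟩⟩
  · refine hL.entails_iff.1 hent A hA (fun _ => a) fun ψ hψ => ?_
    refine (hL.designated_equivForms hA _ _).2 ?_ ψ (hg' ψ hψ)
    simpa only [Eqn.Sat, Term.realize_subst, Term.realize_var] using h _ ⟨ψ, hψ, rfl⟩
  · obtain ⟨ψ, hψ, rfl⟩ := hd
    exact h _ (hg ψ hψ)

end Algebraizes

/-! ### The class of algebras of an algebraic expansion -/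

/-- The language `τ_F`. -/
abbrev famLang {ι : Type u} (F : ι → FormSet τ) : FirstOrder.Language.{u, v} :=
  addOps τ (fun i => (F i).n) fun i => (F i).m

/-- The inclusion of `τ` in `τ_F`. -/
abbrev famIncl {ι : Type u} (F : ι → FormSet τ) : τ →ᴸ famLang F :=
  incl τ (fun i => (F i).n) fun i => (F i).m

/-- The tuples `x`, `z` of elements of `A` make all the formulas of `Φ` designated. -/
def FormSet.Sat (ε : Set (Eqn τ (Fin 1))) (A : Alg τ) (Φ : FormSet τ) (x : Fin Φ.n → A.carrier)
    (z : Fin Φ.m → A.carrier) : Prop :=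
  ∀ φ ∈ Φ.forms, Designated ε A (φ.realize (Sum.elim x z))

theorem FormSet.holds_iff {A : Alg τ} {Φ : FormSet τ} :
    Φ.Holds ε A ↔ ∀ x, ∃! z, Φ.Sat ε A x z := by
  simp only [FormSet.Holds, forall_defEqns, FormSet.Sat]

/-- The value `f^i_j(x)` in a `τ_F`-algebra. -/
def famOp {ι : Type u} {F : ι → FormSet τ} (A : Alg (famLang F)) (i : ι)
    (x : Fin (F i).n → A.carrier) (j : Fin (F i).m) : A.carrier :=
  Structure.funMap (newOp τ (fun i => (F i).n) (fun i => (F i).m) i j) x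

/-- The `τ_F`-algebras with `τ`-reduct in `Q` in which the new operations yield the unique
solutions of the conditions `e(Φ)`, for `Φ` in the family `F`. -/
def famClass (ε : Set (Eqn τ (Fin 1))) (Q : Set (Alg τ)) {ι : Type u} (F : ι → FormSet τ) :
    Set (Alg (famLang F)) :=
  {A | A.reduct (famIncl F) ∈ Q ∧ ∀ i,
    (∀ x, (F i).Sat ε (A.reduct (famIncl F)) x (famOp A i x)) ∧
    ∀ x y z, (F i).Sat ε (A.reduct (famIncl F)) x y → (F i).Sat ε (A.reduct (famIncl F)) x z →
      y = z}

/-- The subclass of `Q` defined by the conditions `e(Φ)`, for `Φ` in the family `F`. -/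
def famMod (ε : Set (Eqn τ (Fin 1))) (Q : Set (Alg τ)) {ι : Type u} (F : ι → FormSet τ) :
    Set (Alg τ) :=
  Q ∩ {A | ∀ i, (F i).Holds ε A}

section Family

variable {Q : Set (Alg τ)} {ι ι' : Type u} {F : ι → FormSet τ} {F' : ι' → FormSet τ}

theorem reduct_mem_famMod {A : Alg (famLang F)} (hA : A ∈ famClass ε Q F) :
    A.reduct (famIncl F) ∈ famMod ε Q F :=
  ⟨hA.1, fun i => FormSet.holds_iff.2 fun x =>
    ⟨_, (hA.2 i).1 x, fun y hy => (hA.2 i).2 x y _ hy ((hA.2 i).1 x)⟩⟩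

/-- An algebra satisfying the conditions `e(Φ)` has an expansion by the functions they define. -/
theorem exists_expansion [τ.IsAlgebraic] {A : Alg τ} (hA : A ∈ famMod ε Q F) :
    ∃ B ∈ famClass ε Q F, B.reduct (famIncl F) = A := by
  obtain ⟨hQ, h⟩ := hA
  have h' : ∀ i x, ∃! z, (F i).Sat ε A x z := fun i => FormSet.holds_iff.1 (h i)
  choose g hg hu using fun i x => (h' i x)
  let s : (famLang F).Structure A.carrier :=
    { funMap := fun {n} f x => match n, f, x with
        | _, Sum.inl f, x => Structure.funMap f x
        | _, Sum.inr (NewFn.mk i j), x => g i x j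
      RelMap := fun r => isEmptyElim r }
  have hstr : @LHom.reduct _ _ (famIncl F) A.carrier s = A.str :=
    Structure.ext rfl (by funext n r; exact isEmptyElim r)
  have hsat : ∀ i x z, (F i).Sat ε ((@Alg.mk _ A.carrier s A.nonempty).reduct (famIncl F)) x z ↔
      (F i).Sat ε A x z := by
    intro i x z
    unfold Alg.reduct
    rw [hstr]
  have hB : (@Alg.mk _ A.carrier s A.nonempty).reduct (famIncl F) = A := by
    unfold Alg.reduct
    rw [hstr]
  refine ⟨_, ⟨by rw [hB]; exact hQ, fun i =>
    ⟨fun x => (hsat i x _).2 (hg i x), fun x y z hy hz => ?_⟩⟩, hB⟩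
  exact (hu i x y ((hsat i x y).1 hy)).trans (hu i x z ((hsat i x z).1 hz)).symm

/-- The new operations are determined by the `τ`-reduct. -/
theorem famClass_ext [τ.IsAlgebraic] {A : Alg (famLang F)} {s : (famLang F).Structure A.carrier}
    (hs : @Alg.mk _ A.carrier s A.nonempty ∈ famClass ε Q F) (hA : A ∈ famClass ε Q F)
    (h : (@Alg.mk _ A.carrier s A.nonempty).reduct (famIncl F) = A.reduct (famIncl F)) :
    @Alg.mk _ A.carrier s A.nonempty = A := by
  have hstr : @LHom.reduct _ _ (famIncl F) A.carrier s =
      @LHom.reduct _ _ (famIncl F) A.carrier A.str := by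
    simpa only [Alg.reduct, Alg.mk.injEq, heq_eq_eq, true_and] using h
  have hsat : ∀ i (x : Fin (F i).n → A.carrier) (z : Fin (F i).m → A.carrier),
      (F i).Sat ε ((@Alg.mk _ A.carrier s A.nonempty).reduct (famIncl F)) x z →
      (F i).Sat ε (A.reduct (famIncl F)) x z := by
    intro i x z hz
    unfold Alg.reduct at hz ⊢
    rw [← hstr]
    exact hz
  refine Alg.mk_congr (s' := A.str) fun n f x => ?_
  rcases f with f | ⟨i, j⟩
  · exact congrArg (fun t : τ.Structure A.carrier => t.funMap f x) hstr
  · exact congrFun ((hA.2 i).2 x _ _ (hsat i x _ ((hs.2 i).1 x)) ((hA.2 i).1 x)) j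

end Family

section Completeness

variable {L : SententialLogic τ} {Q : Set (Alg τ)} {Δ : Finset (τ.Term (Fin 2))}
  {ι ι' : Type u} {F : ι → FormSet τ} {F' : ι' → FormSet τ}

/-! ### Soundness -/

theorem realize_incl_subst {τ₁ : FirstOrder.Language.{u, v}} (h : τ →ᴸ τ₁) (A : Alg τ₁)
    {α β : Type} (t : τ.Term α) (σ : α → τ₁.Term β) (w : β → A.carrier) :
    ((h.onTerm t).subst σ).realize w =
      Term.realize (M := (A.reduct h).carrier)
        (fun a => Term.realize (M := A.carrier) w (σ a)) t := by
  rw [Term.realize_subst, realize_reduct]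

theorem realize_plug {τ₁ : FirstOrder.Language.{u, v}} (h : τ →ᴸ τ₁) (A : Alg τ₁) {n m : ℕ}
    (φ : τ.Term (Fin n ⊕ Fin m)) (a : Fin n → Tm τ₁) (b : Fin m → Tm τ₁) (w : ℕ → A.carrier) :
    (plug h φ a b).realize w = Term.realize (M := (A.reduct h).carrier)
      (Sum.elim (fun i => Term.realize (M := A.carrier) w (a i))
        fun j => Term.realize (M := A.carrier) w (b j)) φ := by
  rw [plug, realize_incl_subst]
  congr 1
  funext k
  cases k <;> rfl

theorem realize_incl_pair {τ₁ : FirstOrder.Language.{u, v}} (h : τ →ᴸ τ₁) (A : Alg τ₁) {β : Type}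
    (δ : τ.Term (Fin 2)) (s t : τ₁.Term β) (w : β → A.carrier) :
    ((h.onTerm δ).subst ![s, t]).realize w =
      Term.realize (M := (A.reduct h).carrier)
        ![Term.realize (M := A.carrier) w s, Term.realize (M := A.carrier) w t] δ := by
  rw [realize_incl_subst]
  congr 1
  funext k
  fin_cases k <;> rfl

theorem Derives.sound (hL : Algebraizes L Q Δ ε) {Γ : Set (Tm (famLang F))} {φ : Tm (famLang F)}
    (h : Derives L Δ F Γ φ) {A : Alg (famLang F)} (hA : A ∈ famClass ε Q F) (w : ℕ → A.carrier)
    (hw : ∀ ψ ∈ Γ, Designated ε (A.reduct (famIncl F)) (Term.realize (M := A.carrier) w ψ)) :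
    Designated ε (A.reduct (famIncl F)) (Term.realize (M := A.carrier) w φ) := by
  induction h with
  | hyp h => exact hw _ h
  | base h σ _ ih =>
    rw [realize_incl_subst]
    refine hL.entails_iff.1 h _ hA.1 _ fun ψ hψ => ?_
    rw [← realize_incl_subst]
    exact ih ψ hψ
  | @exist i φ h a =>
    rw [realize_plug]
    exact (hA.2 i).1 (fun k => Term.realize (M := A.carrier) w (a k)) φ h
  | @unique i a b c _ _ j δ hδ ihb ihc =>
    have : (fun j => (b j).realize w) = fun j => (c j).realize w := by
      refine (hA.2 i).2 (fun k => Term.realize (M := A.carrier) w (a k)) _ _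
        (fun φ hφ => ?_) fun φ hφ => ?_
      · have := ihb φ hφ
        rwa [realize_plug] at this
      · have := ihc φ hφ
        rwa [realize_plug] at this
    rw [realize_incl_pair]
    exact (hL.designated_iff_eq hA.1 _ _).2 (congrFun this j) δ hδ

/-! ### The Lindenbaum–Tarski algebra -/

/-- A rule in countably many variables that preserves designated elements in the algebras of `Q`
may be used in derivations, together with all its substitution instances. -/
theorem Derives.of_semantic (hL : Algebraizes L Q Δ ε) {Γ : Set (Tm (famLang F))} {α : Type}
    [Encodable α] (G : Set (τ.Term α)) (φ : τ.Term α)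
    (h : ∀ A ∈ Q, ∀ w : α → A.carrier, (∀ ψ ∈ G, Designated ε A (ψ.realize w)) →
      Designated ε A (φ.realize w)) (σ : α → Tm (famLang F))
    (hd : ∀ ψ ∈ G, Derives L Δ F Γ (((famIncl F).onTerm ψ).subst σ)) :
    Derives L Δ F Γ (((famIncl F).onTerm φ).subst σ) := by
  have : Nonempty (Tm (famLang F)) := ⟨.var 0⟩
  obtain ⟨σ', hσ'⟩ := exists_valuation σ
  have hσ : σ' ∘ Encodable.encode = σ := funext hσ'
  have hent : L.Entails (Term.relabel Encodable.encode '' G) (φ.relabel Encodable.encode) := by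
    refine hL.entails_iff.2 fun A hA w hw => ?_
    rw [Term.realize_relabel]
    refine h A hA _ fun ψ hψ => ?_
    rw [← Term.realize_relabel]
    exact hw _ ⟨ψ, hψ, rfl⟩
  have := Derives.base (F := F) (Δ := Δ) (Γ := Γ) hent σ' (by
    rintro _ ⟨ψ, hψ, rfl⟩
    rw [onTerm_relabel_subst, hσ]
    exact hd ψ hψ)
  rwa [onTerm_relabel_subst, hσ] at this

variable (L Δ F) in
/-- The formulas `Δ(s, t)` are derivable from `Γ`. -/
def Congr (Γ : Set (Tm (famLang F))) (s t : Tm (famLang F)) : Prop :=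
  ∀ δ ∈ Δ, Derives L Δ F Γ (((famIncl F).onTerm δ).subst ![s, t])

/-- A rule between equations that is valid in `Q` holds for the relation `Congr`. -/
theorem Congr.of_semantic (hL : Algebraizes L Q Δ ε) {Γ : Set (Tm (famLang F))} {α : Type}
    [Encodable α] (Θ : Set (Eqn τ α)) (e : Eqn τ α)
    (h : ∀ A ∈ Q, ∀ w : α → A.carrier, (∀ d ∈ Θ, d.Sat A w) → e.Sat A w)
    (σ : α → Tm (famLang F))
    (hd : ∀ d ∈ Θ, Congr L Δ F Γ (((famIncl F).onTerm d.1).subst σ)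
      (((famIncl F).onTerm d.2).subst σ)) :
    Congr L Δ F Γ (((famIncl F).onTerm e.1).subst σ) (((famIncl F).onTerm e.2).subst σ) := by
  have key : ∀ (δ : τ.Term (Fin 2)) (d : Eqn τ α),
      ((famIncl F).onTerm (δ.subst ![d.1, d.2])).subst σ = ((famIncl F).onTerm δ).subst
        ![((famIncl F).onTerm d.1).subst σ, ((famIncl F).onTerm d.2).subst σ] := by
    intro δ d
    rw [onTerm_subst, subst_subst]
    congr 1
    funext k
    fin_cases k <;> rfl
  intro δ hδ
  rw [← key]
  refine Derives.of_semantic hL (⋃ d ∈ Θ, equivForms Δ d) _ (fun A hA w hw => ?_) σ ?_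
  · refine (hL.designated_equivForms hA e w).2 (h A hA w fun d hd => ?_) _ ⟨δ, hδ, rfl⟩
    refine (hL.designated_equivForms hA d w).1 fun φ hφ => hw φ ?_
    simp only [Set.mem_iUnion]
    exact ⟨d, hd, hφ⟩
  · intro ψ hψ
    simp only [Set.mem_iUnion] at hψ
    obtain ⟨d, hdΘ, δ', hδ', rfl⟩ := hψ
    rw [key]
    exact hd d hdΘ δ' hδ'

theorem Congr.equivalence (hL : Algebraizes L Q Δ ε) (Γ : Set (Tm (famLang F))) :
    Equivalence (Congr L Δ F Γ) where
  refl s := Congr.of_semantic hL (α := Fin 1) ∅ (.var 0, .var 0) (fun _ _ _ _ => rfl)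
    (fun _ => s) (by simp)
  symm {s t} h := Congr.of_semantic hL (α := Fin 2) {((.var 0, .var 1) : Eqn τ (Fin 2))}
    (.var 1, .var 0) (fun _ _ _ hw => (hw (.var 0, .var 1) rfl).symm) ![s, t]
    (by rintro _ rfl; exact h)
  trans {s t r} h h' := Congr.of_semantic hL (α := Fin 3)
    {((.var 0, .var 1) : Eqn τ (Fin 3)), ((.var 1, .var 2) : Eqn τ (Fin 3))}
    (.var 0, .var 2) (fun _ _ _ hw =>
      (hw (.var 0, .var 1) (.inl rfl)).trans (hw (.var 1, .var 2) (.inr rfl))) ![s, t, r]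
    (by rintro _ (rfl | rfl); exacts [h, h'])

theorem Congr.func (hL : Algebraizes L Q Δ ε) {Γ : Set (Tm (famLang F))} {n : ℕ}
    (f : τ.Functions n) {a b : Fin n → Tm (famLang F)} (h : ∀ k, Congr L Δ F Γ (a k) (b k)) :
    Congr L Δ F Γ (.func ((famIncl F).onFunction f) a) (.func ((famIncl F).onFunction f) b) := by
  refine Congr.of_semantic hL (α := Fin n ⊕ Fin n)
    (Set.range fun k => (.var (.inl k), .var (.inr k)))
    (.func f fun k => .var (.inl k), .func f fun k => .var (.inr k)) (fun A hA w hw => ?_)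
    (Sum.elim a b) ?_
  · exact congrArg (Structure.funMap f) (funext fun k => hw _ ⟨k, rfl⟩)
  · rintro _ ⟨k, rfl⟩
    exact h k

/-- The setoid of the Lindenbaum–Tarski algebra of the theory generated by `Γ`. -/
def lindSetoid (F : ι → FormSet τ) (hL : Algebraizes L Q Δ ε) (Γ : Set (Tm (famLang F))) :
    Setoid (Tm (famLang F)) :=
  ⟨Congr L Δ F Γ, Congr.equivalence hL Γ⟩

/-- The Lindenbaum–Tarski algebra of the theory generated by `Γ`. The operations are given on
representatives chosen by `Quotient.out`; that the choice is immaterial is `lindMk_func`. -/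
noncomputable def lindAlg [τ.IsAlgebraic] (F : ι → FormSet τ) (hL : Algebraizes L Q Δ ε)
    (Γ : Set (Tm (famLang F))) : Alg (famLang F) where
  carrier := Quotient (lindSetoid F hL Γ)
  str := { funMap := fun f x => Quotient.mk _ (.func f fun k => (x k).out)
           RelMap := fun r => isEmptyElim r }
  nonempty := ⟨Quotient.mk _ (.var 0)⟩

variable [τ.IsAlgebraic]

/-- The class of a formula in the Lindenbaum–Tarski algebra. -/
def lindMk (F : ι → FormSet τ) (hL : Algebraizes L Q Δ ε) (Γ : Set (Tm (famLang F)))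
    (t : Tm (famLang F)) : (lindAlg F hL Γ).carrier :=
  Quotient.mk (lindSetoid F hL Γ) t

/-- A representative of an element of the Lindenbaum–Tarski algebra. -/
noncomputable def lindOut (F : ι → FormSet τ) (hL : Algebraizes L Q Δ ε)
    (Γ : Set (Tm (famLang F))) (x : (lindAlg F hL Γ).carrier) : Tm (famLang F) :=
  Quotient.out (s := lindSetoid F hL Γ) x

variable {hL : Algebraizes L Q Δ ε} {Γ : Set (Tm (famLang F))}

theorem lindMk_eq {s t : Tm (famLang F)} :
    lindMk F hL Γ s = lindMk F hL Γ t ↔ Congr L Δ F Γ s t :=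
  Quotient.eq (r := lindSetoid F hL Γ)

theorem lindMk_out (x : (lindAlg F hL Γ).carrier) : lindMk F hL Γ (lindOut F hL Γ x) = x :=
  Quotient.out_eq (s := lindSetoid F hL Γ) x

theorem lindMk_comp_out {α : Type} (x : α → (lindAlg F hL Γ).carrier) :
    (fun k => lindMk F hL Γ (lindOut F hL Γ (x k))) = x :=
  funext fun k => lindMk_out (x k)

theorem lindMk_subst {α : Type} (t : τ.Term α) (σ : α → Tm (famLang F)) :
    lindMk F hL Γ (((famIncl F).onTerm t).subst σ) =
      Term.realize (M := ((lindAlg F hL Γ).reduct (famIncl F)).carrier)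
        (fun a => lindMk F hL Γ (σ a)) t := by
  induction t with
  | var a => rfl
  | @func n f ts ih =>
    refine Eq.trans ?_ (congrArg (fun x : Fin n → (lindAlg F hL Γ).carrier =>
      Structure.funMap ((famIncl F).onFunction f) x) (funext ih))
    exact lindMk_eq.2 (Congr.func hL f fun k => lindMk_eq.1 (lindMk_out _).symm)

theorem lindMk_plug {n m : ℕ} (φ : τ.Term (Fin n ⊕ Fin m)) (a : Fin n → Tm (famLang F))
    (b : Fin m → Tm (famLang F)) :
    lindMk F hL Γ (plug (famIncl F) φ a b) =
      Term.realize (M := ((lindAlg F hL Γ).reduct (famIncl F)).carrier)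
        (Sum.elim (fun i => lindMk F hL Γ (a i)) fun j => lindMk F hL Γ (b j)) φ := by
  rw [plug, lindMk_subst]
  congr 1
  funext k
  cases k <;> rfl

/-- A formula is derivable from `Γ` iff its class is designated. -/
theorem designated_lindMk {t : Tm (famLang F)} :
    Designated ε ((lindAlg F hL Γ).reduct (famIncl F)) (lindMk F hL Γ t) ↔
      Derives L Δ F Γ t := by
  have key : ∀ (δ : τ.Term (Fin 2)) (d : Eqn τ (Fin 1)),
      ((famIncl F).onTerm (δ.subst ![d.1, d.2])).subst (fun _ => t) =
        ((famIncl F).onTerm δ).subst ![((famIncl F).onTerm d.1).subst (fun _ => t),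
          ((famIncl F).onTerm d.2).subst (fun _ => t)] := by
    intro δ d
    rw [onTerm_subst, subst_subst]
    congr 1
    funext k
    fin_cases k <;> rfl
  have hsat : Designated ε ((lindAlg F hL Γ).reduct (famIncl F)) (lindMk F hL Γ t) ↔
      ∀ d ∈ ε, Congr L Δ F Γ (((famIncl F).onTerm d.1).subst fun _ => t)
        (((famIncl F).onTerm d.2).subst fun _ => t) := by
    simp only [← lindMk_eq (hL := hL), lindMk_subst]
    rfl
  rw [hsat]
  constructor
  · intro h
    refine Derives.of_semantic hL (α := Fin 1) (⋃ d ∈ ε, equivForms Δ d) (.var 0)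
      (fun A hA w hw d hd => ?_) (fun _ => t) ?_
    · have : w = fun _ => w 0 := funext fun k => by rw [Subsingleton.elim k 0]
      change d.Sat A fun _ => w 0
      rw [← this]
      refine (hL.designated_equivForms hA d w).1 fun φ hφ => hw φ ?_
      simp only [Set.mem_iUnion]
      exact ⟨d, hd, hφ⟩
    · intro ψ hψ
      simp only [Set.mem_iUnion] at hψ
      obtain ⟨d, hd, δ, hδ, rfl⟩ := hψ
      rw [key]
      exact h d hd δ hδ
  · intro h d hd δ hδ
    rw [← key]
    refine Derives.of_semantic hL (α := Fin 1) {.var 0} _ (fun A hA w hw => ?_) (fun _ => t) ?_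
    · refine (hL.designated_equivForms hA d w).2 ?_ _ ⟨δ, hδ, rfl⟩
      have : w = fun _ => w 0 := funext fun k => by rw [Subsingleton.elim k 0]
      rw [this]
      exact hw _ rfl d hd
    · rintro _ rfl
      exact h

theorem sat_lindMk {i : ι} {a : Fin (F i).n → Tm (famLang F)} {b : Fin (F i).m → Tm (famLang F)} :
    (F i).Sat ε ((lindAlg F hL Γ).reduct (famIncl F)) (fun k => lindMk F hL Γ (a k))
      (fun j => lindMk F hL Γ (b j)) ↔
      ∀ φ ∈ (F i).forms, Derives L Δ F Γ (plug (famIncl F) φ a b) := by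
  unfold FormSet.Sat
  simp only [← designated_lindMk (hL := hL), lindMk_plug]

theorem lindAlg_mem (hQ : IsQuasivariety Q) : lindAlg F hL Γ ∈ famClass ε Q F := by
  refine ⟨?_, fun i => ⟨fun (x : _ → (lindAlg F hL Γ).carrier) => ?_,
    fun (x y z : _ → (lindAlg F hL Γ).carrier) hy hz => ?_⟩⟩
  · obtain ⟨R, hR⟩ := hQ
    refine (Set.ext_iff.1 hR _).2 fun q hq (w : _ → (lindAlg F hL Γ).carrier) hw => ?_
    have hmem : ∀ A ∈ Q, q.Holds A := fun A hA => (Set.ext_iff.1 hR A).1 hA q hq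
    have key : ∀ e : Eqn τ ℕ, e.Sat ((lindAlg F hL Γ).reduct (famIncl F)) w ↔
        Congr L Δ F Γ (((famIncl F).onTerm e.1).subst fun k => lindOut F hL Γ (w k))
          (((famIncl F).onTerm e.2).subst fun k => lindOut F hL Γ (w k)) := by
      intro e
      rw [← lindMk_eq (hL := hL), lindMk_subst, lindMk_subst, lindMk_comp_out]
      rfl
    rw [key]
    exact Congr.of_semantic hL {e | e ∈ q.premises} q.conclusion hmem _
      fun d hd => (key d).1 (hw d hd)
  · have := (sat_lindMk (hL := hL) (Γ := Γ) (i := i) (a := fun k => lindOut F hL Γ (x k))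
      (b := fun j => .func (newOp τ (fun i => (F i).n) (fun i => (F i).m) i j)
        fun k => lindOut F hL Γ (x k))).2 fun φ hφ => .exist i hφ _
    rw [lindMk_comp_out x] at this
    exact this
  · rw [← lindMk_comp_out x, ← lindMk_comp_out y] at hy
    rw [← lindMk_comp_out x, ← lindMk_comp_out z] at hz
    funext j
    refine (lindMk_out (y j)).symm.trans (Eq.trans (lindMk_eq.2 ?_) (lindMk_out (z j)))
    exact fun δ hδ => .unique i _ _ _ (sat_lindMk.1 hy) (sat_lindMk.1 hz) j hδ

/-- The quotient map commutes with all operations; for the new ones this follows from the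
uniqueness of the solutions they name. -/
theorem lindMk_func (hQ : IsQuasivariety Q) {n : ℕ} (f : (famLang F).Functions n)
    (a : Fin n → Tm (famLang F)) :
    lindMk F hL Γ (.func f a) =
      Structure.funMap (M := (lindAlg F hL Γ).carrier) f fun k => lindMk F hL Γ (a k) := by
  rcases f with f | ⟨i, j⟩
  · exact lindMk_eq.2 (Congr.func hL f fun k => lindMk_eq.1 (lindMk_out _).symm)
  · have hmem := (lindAlg_mem (hL := hL) (F := F) (Γ := Γ) hQ).2 i
    exact congrFun (hmem.2 _ _ _ ((sat_lindMk (hL := hL) (Γ := Γ) (i := i) (a := a)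
      (b := fun j => .func (newOp τ (fun i => (F i).n) (fun i => (F i).m) i j) a)).2
        fun φ hφ => .exist i hφ a) (hmem.1 _)) j

/-- The truth lemma: under the canonical valuation, a formula takes its own class as value. -/
theorem realize_lindMk (hQ : IsQuasivariety Q) (t : Tm (famLang F)) :
    t.realize (fun k => lindMk F hL Γ (.var k)) = lindMk F hL Γ t := by
  induction t with
  | var k => rfl
  | func f ts ih => rw [lindMk_func hQ, Term.realize, funext ih]

/-- Soundness and completeness: derivability from the expansion of `L` by `F` is preservation of
designated elements in the algebras of `famClass ε Q F`. -/
theorem derives_iff (hL : Algebraizes L Q Δ ε) (hQ : IsQuasivariety Q)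
    {Γ : Set (Tm (famLang F))} {φ : Tm (famLang F)} :
    Derives L Δ F Γ φ ↔ ∀ A ∈ famClass ε Q F, ∀ w : ℕ → A.carrier,
      (∀ ψ ∈ Γ, Designated ε (A.reduct (famIncl F)) (Term.realize (M := A.carrier) w ψ)) →
      Designated ε (A.reduct (famIncl F)) (Term.realize (M := A.carrier) w φ) := by
  refine ⟨fun h A hA w hw => h.sound hL hA w hw, fun h => ?_⟩
  rw [← designated_lindMk (hL := hL), ← realize_lindMk hQ]
  refine h _ (lindAlg_mem hQ) _ fun ψ hψ => ?_
  rw [realize_lindMk hQ]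
  exact designated_lindMk.2 (.hyp hψ)

end Completeness

section Translations

variable {L : SententialLogic τ} {Q : Set (Alg τ)} {Δ : Finset (τ.Term (Fin 2))}
  {ι ι' : Type u} {F : ι → FormSet τ} {F' : ι' → FormSet τ} [τ.IsAlgebraic]

/-! ### Morphisms, interpretations and inclusions of subclasses -/

theorem realize_reduct_interp (T : Translation (famIncl F') (famIncl F)) (A : Alg (famLang F))
    {α : Type} (t : τ.Term α) (w : α → A.carrier) :
    Term.realize (M := ((A.interp T).reduct (famIncl F')).carrier) w t =
      Term.realize (M := (A.reduct (famIncl F)).carrier) w t := by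
  refine (realize_reduct (famIncl F') (A.interp T) t w).trans ?_
  refine (realize_interp T A _ w).trans ?_
  rw [T.onTerm_onTerm]
  exact (realize_reduct (famIncl F) A t w).symm

theorem designated_interp (T : Translation (famIncl F') (famIncl F)) (A : Alg (famLang F))
    (a : A.carrier) : Designated ε ((A.interp T).reduct (famIncl F')) a ↔
      Designated ε (A.reduct (famIncl F)) a :=
  forall₂_congr fun d _ => Eq.congr (realize_reduct_interp T A d.1 fun _ => a)
    (realize_reduct_interp T A d.2 fun _ => a)

theorem sat_interp (T : Translation (famIncl F') (famIncl F)) (A : Alg (famLang F)) {Φ : FormSet τ}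
    (x : Fin Φ.n → A.carrier) (z : Fin Φ.m → A.carrier) :
    Φ.Sat ε ((A.interp T).reduct (famIncl F')) x z ↔ Φ.Sat ε (A.reduct (famIncl F)) x z := by
  refine forall₂_congr fun φ _ => ?_
  have := realize_reduct_interp T A φ (Sum.elim x z)
  exact (designated_interp T A _).trans (iff_of_eq (congrArg _ this))

theorem designated_onTerm (T : Translation (famIncl F') (famIncl F)) (A : Alg (famLang F))
    (φ : Tm (famLang F')) (w : ℕ → A.carrier) :
    Designated ε (A.reduct (famIncl F)) (Term.realize (M := A.carrier) w (T.onTerm φ)) ↔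
      Designated ε ((A.interp T).reduct (famIncl F'))
        (Term.realize (M := (A.interp T).carrier) w φ) :=
  (designated_interp T A _).symm.trans (iff_of_eq (congrArg _ (realize_interp T A φ w).symm))

theorem Translation.IsInterpretation.isMorphism (hL : Algebraizes L Q Δ ε) (hQ : IsQuasivariety Q)
    {T : Translation (famIncl F') (famIncl F)}
    (hT : T.IsInterpretation (famClass ε Q F') (famClass ε Q F)) :
    T.IsMorphism (expansion L Δ F') (expansion L Δ F) := by
  intro Γ φ h
  refine (derives_iff hL hQ).2 fun A hA w hw => ?_
  exact (designated_onTerm T A φ w).2 <| Derives.sound hL h (hT A hA) w fun ψ hψ =>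
    (designated_onTerm T A ψ w).1 (hw _ ⟨ψ, hψ, rfl⟩)

theorem Translation.IsMorphism.isInterpretation (hL : Algebraizes L Q Δ ε)
    {T : Translation (famIncl F') (famIncl F)}
    (hT : T.IsMorphism (expansion L Δ F') (expansion L Δ F)) :
    T.IsInterpretation (famClass ε Q F') (famClass ε Q F) := by
  intro A hA
  -- rules of the expansion by `F'` preserve the designated elements of the interpreted algebra
  have sound : ∀ Γ φ, Derives L Δ F' Γ φ → ∀ w : ℕ → A.carrier,
      (∀ ψ ∈ Γ, Designated ε ((A.interp T).reduct (famIncl F'))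
        (Term.realize (M := (A.interp T).carrier) w ψ)) →
      Designated ε ((A.interp T).reduct (famIncl F'))
        (Term.realize (M := (A.interp T).carrier) w φ) := by
    intro Γ φ h w hw
    refine (designated_onTerm T A φ w).1 (Derives.sound hL (hT Γ φ h) hA w ?_)
    rintro _ ⟨ψ, hψ, rfl⟩
    exact (designated_onTerm T A ψ w).2 (hw ψ hψ)
  have hred : (A.interp T).reduct (famIncl F') ∈ Q := by
    rw [reduct_interp]
    exact hA.1
  refine ⟨hred, fun i => ⟨fun x φ hφ => ?_, fun (x y z : _ → (A.interp T).carrier) hy hz => ?_⟩⟩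
  · obtain ⟨w, hw⟩ := exists_valuation (M := (A.interp T).carrier) x
    have := sound ∅ _ (.exist i hφ fun k => .var (Encodable.encode k)) w (by simp)
    rw [realize_plug] at this
    have hx : (fun k => Term.realize (M := (A.interp T).carrier) w
        (.var (Encodable.encode k) : Tm (famLang F'))) = x := funext hw
    simp only [Term.realize] at this hx
    rw [hx] at this
    exact this
  · obtain ⟨w, hw⟩ := exists_valuation (M := (A.interp T).carrier) (Sum.elim x (Sum.elim y z))
    -- distinct variables standing for the entries of `x`, `y` and `z`
    let vx : Fin (F' i).n → Tm (famLang F') := fun k =>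
      .var (Encodable.encode (.inl k : Fin (F' i).n ⊕ (Fin (F' i).m ⊕ Fin (F' i).m)))
    let vy : Fin (F' i).m → Tm (famLang F') := fun j =>
      .var (Encodable.encode (.inr (.inl j) : Fin (F' i).n ⊕ (Fin (F' i).m ⊕ Fin (F' i).m)))
    let vz : Fin (F' i).m → Tm (famLang F') := fun j =>
      .var (Encodable.encode (.inr (.inr j) : Fin (F' i).n ⊕ (Fin (F' i).m ⊕ Fin (F' i).m)))
    have hx : (fun k => Term.realize (M := (A.interp T).carrier) w (vx k)) = x :=
      funext fun k => hw _
    have hy' : (fun k => Term.realize (M := (A.interp T).carrier) w (vy k)) = y :=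
      funext fun k => hw _
    have hz' : (fun k => Term.realize (M := (A.interp T).carrier) w (vz k)) = z :=
      funext fun k => hw _
    funext j
    rw [← hy', ← hz']
    refine (hL.designated_iff_eq hred _ _).1 fun δ hδ => ?_
    rw [← realize_incl_pair]
    refine sound ({ψ | ∃ φ ∈ (F' i).forms, ψ = plug (famIncl F') φ vx vy} ∪
      {ψ | ∃ φ ∈ (F' i).forms, ψ = plug (famIncl F') φ vx vz}) _
      (.unique i vx vy vz (fun φ hφ => .hyp (.inl ⟨φ, hφ, rfl⟩))
        (fun φ hφ => .hyp (.inr ⟨φ, hφ, rfl⟩)) j hδ) w ?_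
    rintro _ (⟨φ, hφ, rfl⟩ | ⟨φ, hφ, rfl⟩)
    · rw [realize_plug, hx, hy']
      exact hy φ hφ
    · rw [realize_plug, hx, hz']
      exact hz φ hφ

theorem exists_isMorphism_iff (hL : Algebraizes L Q Δ ε) (hQ : IsQuasivariety Q) :
    (∃ T : Translation (famIncl F') (famIncl F),
      T.IsMorphism (expansion L Δ F') (expansion L Δ F)) ↔
    ∃ T : Translation (famIncl F') (famIncl F),
      T.IsInterpretation (famClass ε Q F') (famClass ε Q F) :=
  ⟨fun ⟨T, hT⟩ => ⟨T, hT.isInterpretation hL⟩, fun ⟨T, hT⟩ => ⟨T, hT.isMorphism hL hQ⟩⟩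

theorem famMod_subset_of_interpretation
    (h : ∃ T : Translation (famIncl F') (famIncl F),
      T.IsInterpretation (famClass ε Q F') (famClass ε Q F)) :
    famMod ε Q F ⊆ famMod ε Q F' := by
  obtain ⟨T, hT⟩ := h
  intro A hA
  obtain ⟨B, hB, rfl⟩ := exists_expansion hA
  rw [← reduct_interp T]
  exact reduct_mem_famMod (hT B hB)

/-- If `famMod ε Q F ⊆ famMod ε Q F'`, the functions defined by `F'` in the algebras of
`famClass ε Q F` are given by terms: solve the condition `e(Φ)` at distinct variables in the
Lindenbaum–Tarski algebra of the theorems, and replace the variables that are not among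
`x₁, …, xₙ` by a term `c`. -/
theorem exists_terms (hL : Algebraizes L Q Δ ε) (hQ : IsQuasivariety Q) {Φ : FormSet τ}
    (h : ∀ A ∈ famMod ε Q F, Φ.Holds ε A) (c : (famLang F).Term (Fin Φ.n)) :
    ∃ t : Fin Φ.m → (famLang F).Term (Fin Φ.n), ∀ A ∈ famClass ε Q F,
      ∀ x : Fin Φ.n → A.carrier, Φ.Sat ε (A.reduct (famIncl F)) x
        fun j => Term.realize (M := A.carrier) x (t j) := by
  obtain ⟨z, hz, -⟩ := FormSet.holds_iff.1 (h _ (reduct_mem_famMod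
    (lindAlg_mem (hL := hL) (F := F) (Γ := ∅) hQ)))
    fun k => lindMk F hL ∅ (.var (Encodable.encode k))
  obtain ⟨σ, hσ⟩ : ∃ σ : ℕ → (famLang F).Term (Fin Φ.n),
      ∀ k, σ (Encodable.encode k) = .var k := by
    have : Nonempty ((famLang F).Term (Fin Φ.n)) := ⟨c⟩
    exact exists_valuation _
  refine ⟨fun j => (lindOut F hL ∅ (z j)).subst σ, fun A hA x φ hφ => ?_⟩
  have hd : Derives L Δ F ∅ (plug (famIncl F) φ (fun k => .var (Encodable.encode k))
      fun j => lindOut F hL ∅ (z j)) := by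
    have := hz φ hφ
    rw [← lindMk_comp_out (hL := hL) (F := F) z, ← lindMk_plug] at this
    exact designated_lindMk.1 this
  have := hd.sound hL hA (fun k => Term.realize (M := A.carrier) x (σ k)) (by simp)
  rw [realize_plug] at this
  simp only [Term.realize_var, hσ] at this
  simp only [Term.realize_subst]
  exact this

theorem exists_interpretation_of_famMod_subset (hL : Algebraizes L Q Δ ε) (hQ : IsQuasivariety Q)
    (hc : Nonempty ((famLang F').Functions 0) → Nonempty ((famLang F).Functions 0))
    (h : famMod ε Q F ⊆ famMod ε Q F') :
    ∃ T : Translation (famIncl F') (famIncl F),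
      T.IsInterpretation (famClass ε Q F') (famClass ε Q F) := by
  have hterm : ∀ i, ∃ t : Fin (F' i).m → (famLang F).Term (Fin (F' i).n), ∀ A ∈ famClass ε Q F,
      ∀ x : Fin (F' i).n → A.carrier, (F' i).Sat ε (A.reduct (famIncl F)) x
        fun j => Term.realize (M := A.carrier) x (t j) := by
    intro i
    have hsol : ∀ A ∈ famMod ε Q F, (F' i).Holds ε A := fun A hA => (h hA).2 i
    by_cases hn : Nonempty ((famLang F).Term (Fin (F' i).n))
    · exact exists_terms hL hQ hsol hn.some
    -- without terms in `n` variables, `n = 0` and no new symbol is needed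
    have hn0 : (F' i).n = 0 := by
      by_contra h0
      exact hn ⟨.var ⟨0, Nat.pos_of_ne_zero h0⟩⟩
    have hm0 : IsEmpty (Fin (F' i).m) := by
      refine ⟨fun j => hn ?_⟩
      have : Nonempty ((famLang F').Functions 0) :=
        hn0 ▸ ⟨newOp τ (fun i => (F' i).n) (fun i => (F' i).m) i j⟩
      exact ⟨.func (hc this).some Fin.elim0⟩
    refine ⟨fun j => hm0.elim j, fun A hA x => ?_⟩
    obtain ⟨z, hz, -⟩ := FormSet.holds_iff.1 (hsol _ (reduct_mem_famMod hA)) x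
    have hz' : z = fun j => Term.realize (M := A.carrier) x
        (hm0.elim j : (famLang F).Term (Fin (F' i).n)) := funext fun j => hm0.elim j
    rw [hz'] at hz
    exact hz
  choose t ht using hterm
  let T : Translation (famIncl F') (famIncl F) :=
    ⟨fun {n} f => match n, f with
      | _, Sum.inl f => .func ((famIncl F).onFunction f) .var
      | _, Sum.inr (NewFn.mk i j) => t i j, fun f => rfl⟩
  refine ⟨T, fun A hA => ?_⟩
  have hmod := h (reduct_mem_famMod hA)
  refine ⟨?_, fun i => ⟨fun x => (sat_interp T A _ _).2 (ht i A hA x), fun x y z hy hz => ?_⟩⟩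
  · rw [reduct_interp]
    exact hA.1
  · exact (FormSet.holds_iff.1 (hmod.2 i) x).unique ((sat_interp T A _ _).1 hy)
      ((sat_interp T A _ _).1 hz)

/-! ### Equipollence and term-equivalence -/

/-- Interpretations in both directions are mutually inverse, because the composites preserve the
`τ`-reduct and the new operations are determined by it. -/
theorem termEquivalent_iff :
    TermEquivalent (famIncl F') (famIncl F) (famClass ε Q F') (famClass ε Q F) ↔
      (∃ T : Translation (famIncl F') (famIncl F),
        T.IsInterpretation (famClass ε Q F') (famClass ε Q F)) ∧
      ∃ T : Translation (famIncl F) (famIncl F'),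
        T.IsInterpretation (famClass ε Q F) (famClass ε Q F') := by
  constructor
  · rintro ⟨T, S, hT, hS, -⟩
    exact ⟨⟨T, hT⟩, S, hS⟩
  · rintro ⟨⟨T, hT⟩, S, hS⟩
    refine ⟨T, S, hT, hS, fun A hA => ?_, fun A hA => ?_⟩
    · refine famClass_ext (hS _ (hT A hA)) hA ?_
      exact (reduct_interp S _).trans (reduct_interp T A)
    · refine famClass_ext (hT _ (hS A hA)) hA ?_
      exact (reduct_interp T _).trans (reduct_interp S A)

theorem interderivable_roundtrip (hL : Algebraizes L Q Δ ε) (hQ : IsQuasivariety Q)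
    {T : Translation (famIncl F') (famIncl F)} {S : Translation (famIncl F) (famIncl F')}
    (h : ∀ A ∈ famClass ε Q F, (A.interp T).interp S = A) (φ : Tm (famLang F)) :
    (expansion L Δ F).Interderivable φ (T.onTerm (S.onTerm φ)) := by
  have key : ∀ A ∈ famClass ε Q F, ∀ w : ℕ → A.carrier,
      Term.realize (M := A.carrier) w (T.onTerm (S.onTerm φ)) =
        Term.realize (M := A.carrier) w φ := by
    intro A hA w
    refine ((realize_interp S (A.interp T) φ w).trans
      (realize_interp T A (S.onTerm φ) w)).symm.trans ?_
    have hstr : ((A.interp T).interp S).str = A.str := Alg.str_eq_of_mk_eq (h A hA)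
    change @Term.realize _ A.carrier ((A.interp T).interp S).str _ w φ = _
    rw [hstr]
  constructor
  · refine (derives_iff hL hQ).2 fun A hA w hw => ?_
    rw [key A hA]
    exact hw _ rfl
  · refine (derives_iff hL hQ).2 fun A hA w hw => ?_
    rw [← key A hA]
    exact hw _ rfl

theorem equipollent_iff_termEquivalent (hL : Algebraizes L Q Δ ε) (hQ : IsQuasivariety Q) :
    Equipollent (famIncl F') (famIncl F) (expansion L Δ F') (expansion L Δ F) ↔
      TermEquivalent (famIncl F') (famIncl F) (famClass ε Q F') (famClass ε Q F) := by
  constructor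
  · rintro ⟨T, S, hT, hS, -⟩
    exact termEquivalent_iff.2 ⟨⟨T, hT.isInterpretation hL⟩, S, hS.isInterpretation hL⟩
  · rintro ⟨T, S, hT, hS, hTS, hST⟩
    exact ⟨T, S, hT.isMorphism hL hQ, hS.isMorphism hL hQ, interderivable_roundtrip hL hQ hST,
      interderivable_roundtrip hL hQ hTS⟩

theorem famMod_eq_of_termEquivalent
    (h : TermEquivalent (famIncl F') (famIncl F) (famClass ε Q F') (famClass ε Q F)) :
    famMod ε Q F = famMod ε Q F' :=
  have ⟨h₁, h₂⟩ := termEquivalent_iff.1 h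
  (famMod_subset_of_interpretation h₁).antisymm (famMod_subset_of_interpretation h₂)

theorem termEquivalent_of_famMod_eq (hL : Algebraizes L Q Δ ε) (hQ : IsQuasivariety Q)
    (hc : Nonempty ((famLang F').Functions 0) ↔ Nonempty ((famLang F).Functions 0))
    (h : famMod ε Q F = famMod ε Q F') :
    TermEquivalent (famIncl F') (famIncl F) (famClass ε Q F') (famClass ε Q F) :=
  termEquivalent_iff.2 ⟨exists_interpretation_of_famMod_subset hL hQ hc.1 h.subset,
    exists_interpretation_of_famMod_subset hL hQ hc.2 h.superset⟩

end Translations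

section Families

variable {L : SententialLogic τ} {Q : Set (Alg τ)} {Δ : Finset (τ.Term (Fin 2))}

/-! ### Sets of EFD-sentences as families of sets of formulas -/

theorem sat_toFormSet (hL : Algebraizes L Q Δ ε) {A : Alg τ} (hA : A ∈ Q) (φ : EFD τ)
    (x : Fin φ.n → A.carrier) (z : Fin φ.m → A.carrier) :
    (φ.toFormSet Δ).Sat ε A x z ↔ ∀ e ∈ φ.eqs, e.Sat A (Sum.elim x z) := by
  refine Iff.trans ?_ (forall₂_congr fun e _ => hL.designated_equivForms hA e (Sum.elim x z))
  constructor
  · intro h e he ψ hψ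
    exact h ψ (Set.mem_biUnion (t := equivForms Δ) (s := {e | e ∈ φ.eqs}) he hψ)
  · intro h ψ hψ
    obtain ⟨e, he, hψ⟩ := Set.mem_iUnion₂.1 hψ
    exact h e he ψ hψ

theorem holds_toFormSet (hL : Algebraizes L Q Δ ε) {A : Alg τ} (hA : A ∈ Q) (φ : EFD τ) :
    (φ.toFormSet Δ).Holds ε A ↔ φ.Holds A := by
  refine FormSet.holds_iff.trans (forall_congr' fun x => ?_)
  exact existsUnique_congr fun z => sat_toFormSet hL hA φ x z

theorem famMod_toFormSet (hL : Algebraizes L Q Δ ε) (S : Set (EFD τ)) :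
    famMod ε Q (fun φ : S => φ.1.toFormSet Δ) = Q ∩ ModEFD S := by
  ext A
  refine and_congr_right fun hA => ?_
  simp only [Set.mem_ofPred_eq, holds_toFormSet hL hA, ModEFD, Subtype.forall]

theorem famClass_toFormSet (hL : Algebraizes L Q Δ ε) (S : Set (EFD τ)) :
    famClass ε Q (fun φ : S => φ.1.toFormSet Δ) = classExpansion Q S := by
  ext A
  refine and_congr_right fun hA => forall_congr' fun φ => and_congr ?_ ?_
  · exact forall_congr' fun x => sat_toFormSet hL hA φ.1 x _
  · exact forall₃_congr fun x y z => imp_congr (sat_toFormSet hL hA φ.1 x y)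
      (imp_congr (sat_toFormSet hL hA φ.1 x z) Iff.rfl)

/-- Every condition `e(Φ)` is equivalent over `Q` to an EFD-sentence with at least one universally
quantified variable. A new universal variable `x₀` and a new existential variable `z₀` are added,
with the equation `z₀ = x₀`; this makes no difference since algebras are nonempty. -/
theorem exists_efd (hL : Algebraizes L Q Δ ε) (Φ : FormSet τ) :
    ∃ φ : EFD τ, 1 ≤ φ.n ∧ ∀ A ∈ Q, (φ.Holds A ↔ Φ.Holds ε A) := by
  obtain ⟨ε₀, hfin, hε⟩ := hL.exists_finite_defEqns
  let ren : Eqn τ (Fin Φ.n ⊕ Fin Φ.m) → Eqn τ (Fin (Φ.n + 1) ⊕ Fin (Φ.m + 1)) :=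
    Prod.map (Term.relabel (Sum.map Fin.succ Fin.succ)) (Term.relabel (Sum.map Fin.succ Fin.succ))
  have hE : (ren '' ⋃ φ ∈ Φ.forms, defEqns ε₀ φ).Finite := by
    refine (Φ.finite.biUnion fun φ _ => ?_).image _
    refine (hfin.image fun d => (d.1.subst fun _ => φ, d.2.subst fun _ => φ)).subset ?_
    rintro _ ⟨d, hd, rfl⟩
    exact ⟨d, hd, rfl⟩
  refine ⟨⟨Φ.n + 1, Φ.m + 1, Nat.le_add_left 1 _,
    (.var (.inr 0), .var (.inl 0)) :: hE.toFinset.toList⟩, Nat.le_add_left 1 _, fun A hA => ?_⟩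
  have key : ∀ (x : Fin (Φ.n + 1) → A.carrier) (z : Fin (Φ.m + 1) → A.carrier),
      (∀ e ∈ ((.var (.inr 0), .var (.inl 0)) :: hE.toFinset.toList : List (Eqn τ _)),
        e.Sat A (Sum.elim x z)) ↔ z 0 = x 0 ∧ Φ.Sat ε A (Fin.tail x) (Fin.tail z) := by
    intro x z
    rw [List.forall_mem_cons]
    refine and_congr Iff.rfl ?_
    have hren : ∀ e : Eqn τ (Fin Φ.n ⊕ Fin Φ.m), (ren e).Sat A (Sum.elim x z) ↔
        e.Sat A (Sum.elim (Fin.tail x) (Fin.tail z)) := by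
      intro e
      have : Sum.elim x z ∘ Sum.map Fin.succ Fin.succ = Sum.elim (Fin.tail x) (Fin.tail z) :=
        funext fun k => by cases k <;> rfl
      simp only [Eqn.Sat, ren, Prod.map, Term.realize_relabel, this]
    simp only [Finset.mem_toList, Set.Finite.mem_toFinset, Set.forall_mem_image, hren,
      Set.mem_iUnion, FormSet.Sat, ← hε A hA, ← forall_defEqns]
    exact ⟨fun h φ hφ e he => h ⟨φ, hφ, he⟩, fun h e ⟨φ, hφ, he⟩ => h φ hφ e he⟩
  rw [FormSet.holds_iff]
  unfold EFD.Holds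
  simp only [key]
  constructor
  · intro h x
    obtain ⟨c⟩ := A.nonempty
    obtain ⟨z, ⟨hz0, hz⟩, hu⟩ := h (Fin.cons c x)
    refine ⟨Fin.tail z, hz, fun y hy => ?_⟩
    rw [← hu (Fin.cons c y) ⟨rfl, hy⟩, Fin.tail_cons]
  · intro h x
    obtain ⟨z, hz, hu⟩ := h (Fin.tail x)
    refine ⟨Fin.cons (x 0) z, ⟨rfl, hz⟩, fun y hy => ?_⟩
    rw [← hu _ hy.2, ← hy.1, Fin.cons_self_tail]

/-! ### The two lattices -/

/-- The AE-subclasses of `Q` form a lattice under inclusion: the meet of two of them is the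
intersection, and their join is defined by all EFD-sentences that hold in both. -/
@[reducible] def AESubclass.lattice (Q : Set (Alg τ)) : Lattice (AESubclass Q) where
  le K K' := K.cls ⊆ K'.cls
  le_refl _ := subset_rfl
  le_trans _ _ _ := Set.Subset.trans
  le_antisymm := by
    rintro ⟨K, _⟩ ⟨K', _⟩ h h'
    congr
    exact h.antisymm h'
  sup K K' := ⟨Q ∩ ModEFD {φ | ∀ A ∈ K.cls ∪ K'.cls, φ.Holds A}, _, rfl⟩
  le_sup_left K K' A hA := by
    obtain ⟨S, hS⟩ := K.isAE
    exact ⟨(hS ▸ hA : A ∈ Q ∩ ModEFD S).1, fun φ hφ => hφ A (.inl hA)⟩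
  le_sup_right K K' A hA := by
    obtain ⟨S, hS⟩ := K'.isAE
    exact ⟨(hS ▸ hA : A ∈ Q ∩ ModEFD S).1, fun φ hφ => hφ A (.inr hA)⟩
  sup_le K K' K'' h h' A hA := by
    obtain ⟨S, hS⟩ := K''.isAE
    rw [hS] at h h' ⊢
    refine ⟨hA.1, fun φ hφ => hA.2 φ ?_⟩
    rintro B (hB | hB)
    exacts [(h hB).2 φ hφ, (h' hB).2 φ hφ]
  inf K K' := ⟨K.cls ∩ K'.cls, by
    obtain ⟨S, hS⟩ := K.isAE
    obtain ⟨S', hS'⟩ := K'.isAE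
    refine ⟨S ∪ S', ?_⟩
    rw [hS, hS', ← Set.inter_inter_distrib_left]
    congr 1
    ext A
    exact ⟨fun h φ hφ => hφ.elim (h.1 φ) (h.2 φ),
      fun h => ⟨fun φ hφ => h φ (.inl hφ), fun φ hφ => h φ (.inr hφ)⟩⟩⟩
  inf_le_left _ _ := Set.inter_subset_left
  inf_le_right _ _ := Set.inter_subset_right
  le_inf _ _ _ := Set.subset_inter

/-- A lattice structure transported along an order-reversing bijection. -/
@[reducible] def dualLattice {α β : Type*} (lat : Lattice β) (e : α ≃ β) : Lattice α where
  le a b := e b ≤ e a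
  le_refl _ := le_rfl
  le_trans _ _ _ h h' := h'.trans h
  le_antisymm _ _ h h' := e.injective (h'.antisymm h)
  sup a b := e.symm (e a ⊓ e b)
  le_sup_left _ _ := by simp
  le_sup_right _ _ := by simp
  sup_le _ _ _ h h' := by simpa using ⟨h, h'⟩
  inf a b := e.symm (e a ⊔ e b)
  inf_le_left _ _ := by simp
  inf_le_right _ _ := by simp
  le_inf _ _ _ h h' := by simpa using ⟨h, h'⟩

theorem isAE_famMod (hL : Algebraizes L Q Δ ε) {ι : Type u} (F : ι → FormSet τ) :
    ∃ S : Set (EFD τ), famMod ε Q F = Q ∩ ModEFD S := by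
  choose g _ hg using fun i => exists_efd hL (F i)
  refine ⟨Set.range g, ?_⟩
  ext A
  refine and_congr_right fun hA => ?_
  simp only [Set.mem_ofPred_eq, ModEFD, Set.forall_mem_range, hg _ A hA]

theorem exists_functions_zero_iff (P : Presentation τ) :
    Nonempty ((famLang P.F).Functions 0) ↔ Nonempty (τ.Functions 0) :=
  ⟨P.const, fun ⟨f⟩ => ⟨Sum.inl f⟩⟩

variable [τ.IsAlgebraic]

theorem presentation_le_iff (hL : Algebraizes L Q Δ ε) (hQ : IsQuasivariety Q)
    {P P' : Presentation τ} :
    Presentation.Le L Δ P P' ↔ famMod ε Q P'.F ⊆ famMod ε Q P.F := by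
  refine (exists_isMorphism_iff hL hQ).trans ⟨famMod_subset_of_interpretation, ?_⟩
  exact exists_interpretation_of_famMod_subset hL hQ fun h =>
    (exists_functions_zero_iff P').2 (P.const h)

theorem equipollent_presentation_iff (hL : Algebraizes L Q Δ ε) (hQ : IsQuasivariety Q)
    {P P' : Presentation τ} :
    (equipollence L Δ).r P P' ↔ famMod ε Q P.F = famMod ε Q P'.F := by
  refine (equipollent_iff_termEquivalent hL hQ).trans
    ⟨fun h => (famMod_eq_of_termEquivalent h).symm, fun h => ?_⟩
  exact termEquivalent_of_famMod_eq hL hQ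
    ((exists_functions_zero_iff P).trans (exists_functions_zero_iff P').symm) h.symm

/-- The map that sends the class of `L^F` to `Q ∩ Mod(e(F))`. -/
def Expansions.toAESubclass (hL : Algebraizes L Q Δ ε) (hQ : IsQuasivariety Q)
    (E : Expansions L Δ) : AESubclass Q :=
  Quotient.liftOn E (fun P => ⟨famMod ε Q P.F, isAE_famMod hL P.F⟩) fun P P' h => by
    congr 1
    exact (equipollent_presentation_iff hL hQ).1 h

theorem Expansions.le_iff (hL : Algebraizes L Q Δ ε) (hQ : IsQuasivariety Q)
    (E E' : Expansions L Δ) :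
    E.Le E' ↔ (E'.toAESubclass hL hQ).cls ⊆ (E.toAESubclass hL hQ).cls := by
  induction E using Quotient.inductionOn
  induction E' using Quotient.inductionOn
  exact presentation_le_iff hL hQ

theorem Expansions.toAESubclass_bijective (hL : Algebraizes L Q Δ ε) (hQ : IsQuasivariety Q) :
    Function.Bijective (Expansions.toAESubclass hL hQ) := by
  constructor
  · intro E E' h
    induction E using Quotient.inductionOn
    induction E' using Quotient.inductionOn
    exact Quotient.sound ((equipollent_presentation_iff hL hQ).2 (congrArg AESubclass.cls h))
  · rintro ⟨K, S, rfl⟩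
    -- sentences with a universally quantified variable introduce no new constant symbols
    choose g hg hg' using fun φ : S => exists_efd hL (φ.1.toFormSet Δ)
    have hconst : ∀ k, NewFn (fun φ => ((g φ).toFormSet Δ).n) (fun φ => ((g φ).toFormSet Δ).m) k →
        k ≠ 0 := by
      rintro _ ⟨φ, j⟩
      exact Nat.one_le_iff_ne_zero.1 (hg φ)
    refine ⟨Quotient.mk _ ⟨S, fun φ => (g φ).toFormSet Δ, ?_⟩, ?_⟩
    · rintro ⟨f | f⟩
      · exact ⟨f⟩
      · exact absurd rfl (hconst 0 f)
    · change AESubclass.mk _ _ = _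
      congr 1
      ext A
      refine and_congr_right fun hA => ?_
      simp only [Set.mem_ofPred_eq, holds_toFormSet hL hA, hg' _ A hA, ModEFD, Subtype.forall]

end Families
end AlgebraicExpansion

open AlgebraicExpansion
theorem mainTheorem9 {τ : FirstOrder.Language.{u, v}} [τ.IsAlgebraic]
    (L : SententialLogic τ) (Q : Set (Alg τ)) (hQ : IsQuasivariety Q)
    (Δ : Finset (τ.Term (Fin 2))) (ε : Set (Eqn τ (Fin 1))) (hL : Algebraizes L Q Δ ε) :
    -- the equivalences for two given sets of EFD-sentences
    (∀ S S' : Set (EFD τ),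
      -- part 1
      (((∃ T : Translation (EFD.incl S') (EFD.incl S),
            T.IsMorphism (logicExpansion L Δ S') (logicExpansion L Δ S)) ↔
          ∃ T : Translation (EFD.incl S') (EFD.incl S),
            T.IsInterpretation (classExpansion Q S') (classExpansion Q S)) ∧
        ((∃ T : Translation (EFD.incl S') (EFD.incl S),
            T.IsInterpretation (classExpansion Q S') (classExpansion Q S)) →
          Q ∩ ModEFD S ⊆ Q ∩ ModEFD S') ∧
        ((Nonempty ((EFD.lang S').Functions 0) → Nonempty ((EFD.lang S).Functions 0)) →
          Q ∩ ModEFD S ⊆ Q ∩ ModEFD S' →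
          ∃ T : Translation (EFD.incl S') (EFD.incl S),
            T.IsInterpretation (classExpansion Q S') (classExpansion Q S))) ∧
      -- part 2
      ((Equipollent (EFD.incl S') (EFD.incl S) (logicExpansion L Δ S') (logicExpansion L Δ S) ↔
          TermEquivalent (EFD.incl S') (EFD.incl S) (classExpansion Q S') (classExpansion Q S)) ∧
        (TermEquivalent (EFD.incl S') (EFD.incl S) (classExpansion Q S') (classExpansion Q S) →
          Q ∩ ModEFD S = Q ∩ ModEFD S') ∧
        ((Nonempty ((EFD.lang S').Functions 0) ↔ Nonempty ((EFD.lang S).Functions 0)) →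
          Q ∩ ModEFD S = Q ∩ ModEFD S' →
          TermEquivalent (EFD.incl S') (EFD.incl S)
            (classExpansion Q S') (classExpansion Q S)))) ∧
    -- the dual isomorphism of lattices
    ∃ (lat : Lattice (Expansions L Δ)) (latQ : Lattice (AESubclass Q))
      (e : Expansions L Δ ≃ AESubclass Q),
      (∀ E E' : Expansions L Δ, lat.le E E' ↔ E.Le E') ∧
      (∀ K K' : AESubclass Q, latQ.le K K' ↔ K.cls ⊆ K'.cls) ∧
      (∀ E E' : Expansions L Δ, lat.le E E' ↔ latQ.le (e E') (e E)) ∧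
      (∀ P : Presentation τ,
        (e (Expansions.mk L Δ P)).cls = Q ∩ {A | ∀ i, (P.F i).Holds ε A}) ∧
      (∀ (S : Set (EFD τ)) (hS : Nonempty ((EFD.lang S).Functions 0) → Nonempty (τ.Functions 0)),
        (e (Expansions.mk L Δ (EFD.presentation Δ S hS))).cls = Q ∩ ModEFD S) := by
  refine ⟨fun S S' => ?_, ?_⟩
  · have hS := famMod_toFormSet hL S
    have hS' := famMod_toFormSet hL S'
    rw [← hS, ← hS', ← famClass_toFormSet hL S, ← famClass_toFormSet hL S']
    let F : S → FormSet τ := fun φ => φ.1.toFormSet Δ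
    let F' : S' → FormSet τ := fun φ => φ.1.toFormSet Δ
    exact ⟨⟨exists_isMorphism_iff (F := F) (F' := F') hL hQ,
        famMod_subset_of_interpretation (F := F) (F' := F'),
        exists_interpretation_of_famMod_subset (F := F) (F' := F') hL hQ⟩,
      equipollent_iff_termEquivalent (F := F) (F' := F') hL hQ,
      famMod_eq_of_termEquivalent (F := F) (F' := F'),
      termEquivalent_of_famMod_eq (F := F) (F' := F') hL hQ⟩
  · let e := Equiv.ofBijective _ (Expansions.toAESubclass_bijective hL hQ)
    refine ⟨dualLattice (AESubclass.lattice Q) e, AESubclass.lattice Q, e,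
      fun E E' => (Expansions.le_iff hL hQ E E').symm, fun _ _ => Iff.rfl, fun _ _ => Iff.rfl,
      fun _ => rfl, fun S hS => famMod_toFormSet hL S⟩
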